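/- **Definitions.** For an ordered two-letter alphabet $\{x,y\}$ let $G,\tilde G,D,\tilde D$ be the substitutions (monoid endomorphisms of $\{x,y\}^*$) given by $G:(x,y)\mapsto(x,xy)$, $\tilde G:(x,y)\mapsto(x,yx)$, $D:(x,y)\mapsto(yx,y)$, $\tilde D:(x,y)\mapsto(xy,y)$. Under composition, $G,\tilde G,D,\tilde D$ generate the monoid of *special Sturmian* morphisms, and $G,D$ generate the monoid of *special standard* morphisms. The incidence matrix of a substitution $h$ is $M_h=\begin{pmatrix}|h(x)|_x&|h(y)|_x\\|h(x)|_y&|h(y)|_y\end{pmatrix}$. Let $\pi_{s\to t}$ denote the identification of the letter $s$ with the letter $t$. A substitution $\sigma$ of $\{a,b,c\}^*$ has the *apotomic projection* $f$ on $\{a,c\}^*$, $f(a)=\pi_{b\to c}(\sigma(a))$, $f(c)=\pi_{b\to c}(\sigma(bc))$; the *apo-syntonic projection* $g$ on $\{b,c\}^*$, $g(b)=\pi_{a\to b}(\sigma(ab))$, $g(c)=\pi_{a\to b}(\sigma(c))$; and the *syntonic projection* $\tilde g$ on $\{a,b\}^*$, $\tilde g(a)=\pi_{c\to a}(\sigma(ab))$,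 $\tilde g(b)=\pi_{c\to a}(\sigma(c))$. (Alphabets are ordered as listed.) $\sigma$ is an *authentic PWWF substitution* if $f,g,\tilde g$ are all special Sturmian. Two authentic PWWF substitutions $\sigma,\tau$ are *conjugate* if $|\sigma(t)|=|\tau(t)|$ for each letter $t\in\{a,b,c\}$ and the word $\tau(abc)$ is a cyclic rotation of $\sigma(abc)$; $\sigma$ is *reverse-conjugate* to $\tau$ if the lengths agree in the same way and $\tau(abc)$ is a cyclic rotation of the reversal of $\sigma(abc)$. Let $f$ be a special standard morphism of $\{a,c\}^*$ and put $w=f(ac)$, $m=|f(a)|$. If $|w|$ is odd, $|w|_c$ is even and $2m\le|w|$, let $v$ be obtained from $w$ by replacing its successive letters $c$ alternately by $b,c,b,c,\dots$; the *bisecting substitution* $\sigma$ of $f$ is defined by cutting $v=\sigma(a)\sigma(b)\sigma(c)$ with $|\sigma(a)|=|\sigma(b)|=m$. With $R=\begin{pmatrix}1&1\\0&1\end{pmatrix}$ let $$\Sigma_2=\left\{\begin{pmatrix}b_{11}&b_{12}\\b_{21}&2b_{22}\end{pmatrix}R\right\},\qquad \Sigma^2=\left\{R\begin{pmatrix}2b_{11}&b_{12}\\b_{21}&b_{22}\end{pmatrix}\right\},$$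 where in both cases $b_{ij}$ ranges over the non-negative integers with $2b_{11}b_{22}-b_{12}b_{21}=1$. **Corollary.** 1. For every authentic PWWF substitution $\sigma$, exactly one of the following holds: $\sigma$ is conjugate to an authentic bisecting substitution, or $\sigma$ is reverse-conjugate to an authentic bisecting substitution. 2. Every conjugation class of authentic PWWF substitutions that contains a bisecting substitution contains exactly one, and that one is the bisecting substitution of its own apotomic projection, which is special standard. 3. $M_f$ and $M_g$ are constant on each conjugation class of authentic PWWF substitutions. On the set of those conjugation classes that contain a bisecting substitution, $[\sigma]\mapsto M_f$ is a bijection onto $\Sigma_2$ and $[\sigma]\mapsto M_g$ is a bijection onto $\Sigma^2$. 4. Call two authentic PWWF substitutions equivalent if they are conjugate or reverse-conjugate. On the set of equivalence classes of all authentic PWWF substitutions, $[\sigma]\mapsto M_f$ is a well-defined bijection onto $\Sigma_2$, and $[\sigma]\mapsto M_g$ is a well-defined bijection onto $\Sigma^2$. -/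

import Mathlib

/-- The three-letter alphabet `A = {a, b, c}`. -/
inductive Letter
  | a | b | c
  deriving DecidableEq

/-- An ordered two-letter alphabet `{x, y}`. It plays the role of `{a, c}`, of `{b, c}` and of
`{a, b}`, where `x` is the first and `y` the second of the two letters listed. -/
inductive Two
  | x | y
  deriving DecidableEq

/-- Substitutions (monoid endomorphisms) of `{a, b, c}*`. -/
abbrev Subst3 := Monoid.End (FreeMonoid Letter)

/-- Substitutions (monoid endomorphisms) of `{x, y}*`. -/
abbrev Subst2 := Monoid.End (FreeMonoid Two)

/-- The letter `t` as a word. -/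
abbrev word {α : Type} (t : α) : FreeMonoid α := FreeMonoid.of t

/-- The substitution of `{x, y}*` with `x ↦ u` and `y ↦ v`. -/
def subst2 (u v : FreeMonoid Two) : Subst2 :=
  FreeMonoid.lift (fun t => match t with
    | Two.x => u
    | Two.y => v)

/-- `G : x ↦ x, y ↦ xy`. -/
def morG : Subst2 := subst2 (word Two.x) (word Two.x * word Two.y)

/-- `G~ : x ↦ x, y ↦ yx`. -/
def morGt : Subst2 := subst2 (word Two.x) (word Two.y * word Two.x)

/-- `D : x ↦ yx, y ↦ y`. -/
def morD : Subst2 := subst2 (word Two.y * word Two.x) (word Two.y)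

/-- `D~ : x ↦ xy, y ↦ y`. -/
def morDt : Subst2 := subst2 (word Two.x * word Two.y) (word Two.y)

/-- The monoid of special Sturmian morphisms. -/
def specialSturmian : Submonoid Subst2 := Submonoid.closure {morG, morGt, morD, morDt}

/-- The monoid of special standard morphisms. -/
def specialStandard : Submonoid Subst2 := Submonoid.closure {morG, morD}

/-- The letter identification `b → c`, onto `{x, y} = {a, c}`. -/
def piBC : FreeMonoid Letter →* FreeMonoid Two :=
  FreeMonoid.map (fun t => match t with
    | Letter.a => Two.x
    | Letter.b => Two.y
    | Letter.c => Two.y)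

/-- The letter identification `a → b`, onto `{x, y} = {b, c}`. -/
def piAB : FreeMonoid Letter →* FreeMonoid Two :=
  FreeMonoid.map (fun t => match t with
    | Letter.a => Two.x
    | Letter.b => Two.x
    | Letter.c => Two.y)

/-- The letter identification `c → a`, onto `{x, y} = {a, b}`. -/
def piCA : FreeMonoid Letter →* FreeMonoid Two :=
  FreeMonoid.map (fun t => match t with
    | Letter.a => Two.x
    | Letter.b => Two.y
    | Letter.c => Two.x)

/-- The apotomic projection `f` of `σ`: `f(a) = π(σ(a))`, `f(c) = π(σ(bc))` for `π = π_{b → c}`. -/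
def apotomic (σ : Subst3) : Subst2 :=
  subst2 (piBC (σ (word Letter.a))) (piBC (σ (word Letter.b * word Letter.c)))

/-- The apo-syntonic projection `g` of `σ`: `g(b) = π(σ(ab))`, `g(c) = π(σ(c))` for
`π = π_{a → b}`. -/
def apoSyntonic (σ : Subst3) : Subst2 :=
  subst2 (piAB (σ (word Letter.a * word Letter.b))) (piAB (σ (word Letter.c)))

/-- The syntonic projection of `σ`: `a ↦ π(σ(ab))`, `b ↦ π(σ(c))` for `π = π_{c → a}`. -/
def syntonic (σ : Subst3) : Subst2 :=
  subst2 (piCA (σ (word Letter.a * word Letter.b))) (piCA (σ (word Letter.c)))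

/-- Authentic PWWF substitutions. -/
def IsAuthentic (σ : Subst3) : Prop :=
  apotomic σ ∈ specialSturmian ∧ apoSyntonic σ ∈ specialSturmian ∧ syntonic σ ∈ specialSturmian

/-- The type of authentic PWWF substitutions. -/
abbrev AuthenticSubst := {σ : Subst3 // IsAuthentic σ}

/-- The incidence matrix of a substitution of `{x, y}*`; rows count letters, columns are images. -/
def incidence (f : Subst2) : Matrix (Fin 2) (Fin 2) ℕ :=
  !![(f (word Two.x)).toList.count Two.x, (f (word Two.y)).toList.count Two.x;
     (f (word Two.x)).toList.count Two.y, (f (word Two.y)).toList.count Two.y]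

/-- The word `σ(a)σ(b)σ(c)` as a list of letters. -/
def modeWord (σ : Subst3) : List Letter :=
  (σ (word Letter.a * word Letter.b * word Letter.c)).toList

/-- The images of each letter under `σ` and `τ` have the same length (same dividers). -/
def SameLengths (σ τ : Subst3) : Prop :=
  ∀ t : Letter, (σ (word t)).length = (τ (word t)).length

/-- (Letter-by-letter) conjugation: the word `σ(a)σ(b)σ(c)` is cyclically rotated while the
dividers stay in place. -/
def IsConjugate (σ τ : Subst3) : Prop :=
  SameLengths σ τ ∧ (modeWord σ).IsRotated (modeWord τ)

/-- The same for the reversal of the word `σ(a)σ(b)σ(c)`. -/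
def IsReverseConjugate (σ τ : Subst3) : Prop :=
  SameLengths σ τ ∧ (modeWord σ).reverse.IsRotated (modeWord τ)

/-- Conjugation, as an equivalence relation on authentic PWWF substitutions. -/
def conjugation : Setoid AuthenticSubst where
  r σ τ := IsConjugate σ.1 τ.1
  iseqv :=
    { refl := fun _ => ⟨fun _ => rfl, List.IsRotated.refl _⟩
      symm := fun h => ⟨fun t => (h.1 t).symm, h.2.symm⟩
      trans := fun h k => ⟨fun t => (h.1 t).trans (k.1 t), h.2.trans k.2⟩ }

/-- Conjugation up to reversal, as an equivalence relation on authentic PWWF substitutions. -/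
def conjugationUpToReversal : Setoid AuthenticSubst where
  r σ τ := IsConjugate σ.1 τ.1 ∨ IsReverseConjugate σ.1 τ.1
  iseqv :=
    { refl := fun _ => Or.inl ⟨fun _ => rfl, List.IsRotated.refl _⟩
      symm := by
        rintro σ τ (h | h)
        · exact Or.inl ⟨fun t => (h.1 t).symm, h.2.symm⟩
        · refine Or.inr ⟨fun t => (h.1 t).symm, ?_⟩
          have := h.2.reverse
          rw [List.reverse_reverse] at this
          exact this.symm
      trans := by
        rintro σ τ ρ (h | h) (k | k)
        · exact Or.inl ⟨fun t => (h.1 t).trans (k.1 t), h.2.trans k.2⟩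
        · exact Or.inr ⟨fun t => (h.1 t).trans (k.1 t), h.2.reverse.trans k.2⟩
        · exact Or.inr ⟨fun t => (h.1 t).trans (k.1 t), h.2.trans k.2⟩
        · refine Or.inl ⟨fun t => (h.1 t).trans (k.1 t), ?_⟩
          have := h.2.reverse
          rw [List.reverse_reverse] at this
          exact this.trans k.2 }

/-- Conjugation classes of authentic PWWF substitutions. -/
abbrev ConjugationClass := Quotient conjugation

/-- Conjugation classes of authentic PWWF substitutions, each paired with its reversal. -/
abbrev PairedClass := Quotient conjugationUpToReversal

/-- `bisectFrom p w` replaces `x` by `a` and the successive letters `y` of `w` alternately by `b`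
and `c`; `p` says whether the number of letters `y` read so far is odd. -/
def bisectFrom : Bool → List Two → List Letter
  | _, [] => []
  | p, Two.x :: l => Letter.a :: bisectFrom p l
  | false, Two.y :: l => Letter.b :: bisectFrom true l
  | true, Two.y :: l => Letter.c :: bisectFrom false l

/-- The bisection of a word: a letter `y` becomes `b` or `c` according as the number of letters `y`
up to and including it is odd or even. -/
def bisection (w : List Two) : List Letter := bisectFrom false w

/-- `σ` is the bisecting substitution of the special standard morphism `f`. With `w = f(xy)` and
`m = |f(x)|`, the length of `w` is odd, the number of letters `y` in `w` is even, and
`2 m ≤ |w|`, so that the three factors of the bisection of lengths `m`, `m`, `|w| - 2 m` exist. -/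
def IsBisectingOf (f : Subst2) (σ : Subst3) : Prop :=
  f ∈ specialStandard ∧
  Odd (f (word Two.x * word Two.y)).length ∧
  Even ((f (word Two.x * word Two.y)).toList.count Two.y) ∧
  2 * (f (word Two.x)).length ≤ (f (word Two.x * word Two.y)).length ∧
  (σ (word Letter.a)).toList =
    (bisection (f (word Two.x * word Two.y)).toList).take (f (word Two.x)).length ∧
  (σ (word Letter.b)).toList =
    ((bisection (f (word Two.x * word Two.y)).toList).drop (f (word Two.x)).length).take
      (f (word Two.x)).length ∧
  (σ (word Letter.c)).toList =
    (bisection (f (word Two.x * word Two.y)).toList).drop (2 * (f (word Two.x)).length)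

/-- `σ` is a bisecting substitution. -/
def IsBisecting (σ : Subst3) : Prop := ∃ f : Subst2, IsBisectingOf f σ

/-- The conjugation classes that contain a bisecting substitution. -/
def bisectingClasses : Set ConjugationClass :=
  {κ | ∃ σ : AuthenticSubst, IsBisecting σ.1 ∧ Quotient.mk conjugation σ = κ}

/-- `R = (1 1; 0 1)`. -/
def matR : Matrix (Fin 2) (Fin 2) ℕ := !![1, 1; 0, 1]

/-- The set `Σ_2`. -/
def sigmaLower : Set (Matrix (Fin 2) (Fin 2) ℕ) :=
  {M | ∃ b₁₁ b₁₂ b₂₁ b₂₂ : ℕ, 2 * (b₁₁ : ℤ) * b₂₂ - b₁₂ * b₂₁ = 1 ∧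
    M = !![b₁₁, b₁₂; b₂₁, 2 * b₂₂] * matR}

/-- The set `Σ^2`. -/
def sigmaUpper : Set (Matrix (Fin 2) (Fin 2) ℕ) :=
  {M | ∃ b₁₁ b₁₂ b₂₁ b₂₂ : ℕ, 2 * (b₁₁ : ℤ) * b₂₂ - b₁₂ * b₂₁ = 1 ∧
    M = matR * !![2 * b₁₁, b₁₂; b₂₁, b₂₂]}

/-!
The proof describes authentic substitutions explicitly, by orbits of a rotation of `ℤ/n` written as
an exchange of integer intervals.

On two letters, let `h` and `k` be positive coprime integers and `n = h + k`. From a point `u < h`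
of `[0, n)` the letter `x` moves up by `k`, from the other points the letter `y` moves down by `h`.
A substitution `f` is special Sturmian if and only if, for the numbers `h`, `k` of letters of
`f(xy)`, there is a point `s` with `0 ≤ s` and `s + 1 < n` such that `f(x)` is read along an orbit
from `s` to `s + 1` and `f(y)` along its continuation from `s + 1` back to `s`
(`exists_sturmCoded`, `SturmCoded.mem`); `f` is special standard exactly for `s = k - 1`. One
direction holds because each of the four generators refines such an orbit to another one. For the
converse, the Euclidean algorithm produces a special Sturmian morphism for all admissible data, and
the data determine the morphism.

For an authentic `σ` let `u`, `v`, `z` be the positions of the orbits of its apotomic, apo-syntonic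
and syntonic projections, read along `σ(abc)`, and `α` the number of letters `a`. Comparing the
displacements at the dividers modulo `n` gives the same number `β` of letters `b` and `c`, and `α`
is odd. Then `u - v - z` is constant, so the three positions are `u, u + 1, u + 2` at the three
dividers; moreover `v - z` takes only two values, which `b` and `c` exchange. So `b` and `c`
alternate, and the parity of `u` tells which of them is read: `σ` is coded by one orbit on three
letters, with the parity recorded by `ε ∈ {0, 1}` (`IsAuthentic.exists_coded`). Conversely each such
orbit gives an authentic substitution, since `v` and `z` are recovered by halving `u` modulo `n`
(`PWWFCoded.isAuthentic`).

The classification follows. An orbit of length `n` visits every point, so that a conjugation class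
consists of all admissible starting points for fixed `(α, β, ε)`, and the reversal `u ↦ n - 1 - u`
exchanges `ε = 0` with `ε = 1`. A bisecting substitution is one with the starting point `2β - 1`
of a standard morphism and with `b` read at odd points, that is `ε = 0`. Finally `(α, β)`
corresponds to the parameters `bᵢⱼ` of the two sets of matrices by `α = 2b₁₁ + b₁₂` and `β = b₂₁ + b₂₂`
(`params_unique`, `exists_coded_hasParams`).
-/

/-! ### Words coded by exchanges of intervals -/

/-- A rotation of the cyclic group of order `n` by the angle `k`, written on the representatives
`0, …, n - 1`. The letter `t` translates by the integer `δ t`, which is `k` up to a multiple of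
`n`, and `ok t u` says that `t` is the letter read at the point `u`; exactly one letter is read at
each point. -/
structure Coding (A : Type) where
  n : ℤ
  k : ℤ
  δ : A → ℤ
  ok : A → ℤ → Prop
  ok_left : ∀ {t u}, ok t u → 0 ≤ u ∧ u < n
  ok_right : ∀ {t u}, ok t u → 0 ≤ u + δ t ∧ u + δ t < n
  ok_unique : ∀ {t t' u}, ok t u → ok t' u → t = t'
  ok_exists : ∀ {u}, 0 ≤ u → u < n → ∃ t, ok t u
  step_congr : ∀ t, n ∣ δ t - k

namespace Coding

variable {A B : Type}

/-- The total translation along a word. -/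
def disp (C : Coding A) (l : List A) : ℤ := (l.map C.δ).sum

/-- The word `l` is read along the orbit that starts at `u`. -/
def Follows (C : Coding A) : ℤ → List A → Prop
  | _, [] => True
  | u, t :: l => C.ok t u ∧ C.Follows (u + C.δ t) l

@[simp] lemma disp_nil (C : Coding A) : C.disp [] = 0 := rfl

@[simp] lemma disp_cons (C : Coding A) (t : A) (l : List A) :
    C.disp (t :: l) = C.δ t + C.disp l := by simp [disp]

@[simp] lemma disp_append (C : Coding A) (l₁ l₂ : List A) :
    C.disp (l₁ ++ l₂) = C.disp l₁ + C.disp l₂ := by simp [disp]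

@[simp] lemma disp_reverse (C : Coding A) (l : List A) : C.disp l.reverse = C.disp l := by
  simp [disp, List.sum_reverse]

@[simp] lemma follows_nil (C : Coding A) (u : ℤ) : C.Follows u [] := trivial

@[simp] lemma follows_cons (C : Coding A) (u : ℤ) (t : A) (l : List A) :
    C.Follows u (t :: l) ↔ C.ok t u ∧ C.Follows (u + C.δ t) l := Iff.rfl

lemma follows_append (C : Coding A) (l₁ l₂ : List A) : ∀ u : ℤ,
    C.Follows u (l₁ ++ l₂) ↔ C.Follows u l₁ ∧ C.Follows (u + C.disp l₁) l₂ := by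
  induction l₁ with
  | nil => simp
  | cons t l ih =>
    intro u
    simp [ih, and_assoc, add_assoc]

lemma Follows.range {C : Coding A} {l : List A} : ∀ {u : ℤ}, C.Follows u l → 0 ≤ u → u < C.n →
    0 ≤ u + C.disp l ∧ u + C.disp l < C.n := by
  induction l with
  | nil => intro u _ h₀ h₁; simpa using ⟨h₀, h₁⟩
  | cons t l ih =>
    intro u h _ _
    have := ih h.2 (C.ok_right h.1).1 (C.ok_right h.1).2
    simpa [add_assoc] using this

lemma Follows.eq_of_length_eq {C : Coding A} {l : List A} : ∀ {l' : List A} {u : ℤ},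
    C.Follows u l → C.Follows u l' → l.length = l'.length → l = l' := by
  induction l with
  | nil =>
    intro l' u _ _ h
    exact (List.length_eq_zero_iff.mp h.symm).symm
  | cons t l ih =>
    intro l' u h h' hl
    cases l' with
    | nil => simp at hl
    | cons t' l' =>
      obtain rfl := C.ok_unique h.1 h'.1
      rw [ih h.2 h'.2 (by simpa using hl)]

lemma exists_follows (C : Coding A) (m : ℕ) : ∀ {u : ℤ}, 0 ≤ u → u < C.n →
    ∃ l : List A, l.length = m ∧ C.Follows u l := by
  induction m with
  | zero => intro u _ _; exact ⟨[], rfl, trivial⟩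
  | succ m ih =>
    intro u h₀ h₁
    obtain ⟨t, ht⟩ := C.ok_exists h₀ h₁
    obtain ⟨l, hl, h⟩ := ih (C.ok_right ht).1 (C.ok_right ht).2
    exact ⟨t :: l, by simp [hl], ht, h⟩

lemma disp_congr (C : Coding A) (l : List A) : C.n ∣ C.disp l - C.k * l.length := by
  induction l with
  | nil => simp
  | cons t l ih =>
    have h : C.disp (t :: l) - C.k * (t :: l).length =
        C.δ t - C.k + (C.disp l - C.k * l.length) := by
      rw [disp_cons, List.length_cons]
      push_cast
      ring
    rw [h]
    exact dvd_add (C.step_congr t) ih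

/-- The translation along a word is known once it is known modulo `n`. -/
lemma Follows.disp_eq {C : Coding A} {l : List A} {u d : ℤ} (h : C.Follows u l) (h₀ : 0 ≤ u)
    (h₁ : u < C.n) (hd₀ : 0 ≤ u + d) (hd₁ : u + d < C.n) (hd : C.n ∣ d - C.k * l.length) :
    C.disp l = d := by
  have h₂ := h.range h₀ h₁
  have h₃ := dvd_sub (C.disp_congr l) hd
  have h₄ : C.disp l - d = 0 := by
    apply Int.eq_zero_of_abs_lt_dvd (m := C.n)
    · have h₅ : C.disp l - d = C.disp l - C.k * l.length - (d - C.k * l.length) := by ring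
      rwa [h₅]
    · rw [abs_lt]; constructor <;> linarith
  linarith

/-- An orbit of length `n` of a rotation by an invertible angle visits every point. -/
lemma Follows.exists_append {C : Coding A} {l : List A} {u v : ℤ} (h : C.Follows u l) (h₀ : 0 ≤ u)
    (h₁ : u < C.n) (hk : IsCoprime C.k C.n) (hl : (l.length : ℤ) = C.n) (hv₀ : 0 ≤ v)
    (hv₁ : v < C.n) : ∃ l₁ l₂, l = l₁ ++ l₂ ∧ u + C.disp l₁ = v := by
  obtain ⟨x, y, hxy⟩ := hk
  have hn : 0 < C.n := by linarith
  set i := ((v - u) * x) % C.n with hi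
  have hi₀ : 0 ≤ i := Int.emod_nonneg _ hn.ne'
  have hi₁ : i < C.n := Int.emod_lt_of_pos _ hn
  have hlen : (l.take i.toNat).length = i.toNat := by
    rw [List.length_take]; omega
  refine ⟨l.take i.toNat, l.drop i.toNat, (List.take_append_drop _ _).symm, ?_⟩
  have hf : C.Follows u (l.take i.toNat) := by
    have := (follows_append C (l.take i.toNat) (l.drop i.toNat) u).mp
      (by rwa [List.take_append_drop])
    exact this.1
  have : C.disp (l.take i.toNat) = v - u := by
    apply hf.disp_eq h₀ h₁ (by linarith) (by linarith)
    rw [hlen, Int.toNat_of_nonneg hi₀]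
    refine ⟨(v - u) * y + C.k * ((v - u) * x / C.n), ?_⟩
    have h₂ := Int.emod_add_mul_ediv ((v - u) * x) C.n
    have h₃ : i = (v - u) * x - C.n * ((v - u) * x / C.n) := by rw [hi]; linarith
    rw [h₃]
    linear_combination (-(v - u)) * hxy
  linarith

/-- The starting point of an orbit of full length can be read off its word, even when the rule
that selects the letter is not known: the two orbits stay at a constant distance and
both reach `n - 1`. -/
lemma Follows.start_unique {C C' : Coding A} {l : List A} {u v : ℤ} (hδ : C.δ = C'.δ)
    (hn : C.n = C'.n) (hk : C.k = C'.k)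
    (h : C.Follows u l) (h' : C'.Follows v l) (hu₀ : 0 ≤ u) (hu₁ : u < C.n) (hv₀ : 0 ≤ v)
    (hv₁ : v < C'.n) (hc : IsCoprime C.k C.n) (hl : (l.length : ℤ) = C.n) : u = v := by
  have key : ∀ {C C' : Coding A} {u v : ℤ}, C.δ = C'.δ → C.n = C'.n → C.Follows u l →
      C'.Follows v l → 0 ≤ u → u < C.n → 0 ≤ v → v < C'.n → IsCoprime C.k C.n →
      (l.length : ℤ) = C.n → v ≤ u := by
    intro C C' u v hδ hn h h' hu₀ hu₁ hv₀ hv₁ hc hl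
    obtain ⟨l₁, l₂, rfl, h₁⟩ := h.exists_append hu₀ hu₁ hc hl (v := C.n - 1) (by linarith)
      (by linarith)
    have h₂ := ((follows_append C' l₁ l₂ v).mp h').1.range hv₀ hv₁
    have h₃ : C.disp l₁ = C'.disp l₁ := by simp [disp, hδ]
    linarith [h₂.2]
  apply le_antisymm
  · exact key hδ.symm hn.symm h' h hv₀ hv₁ hu₀ hu₁ (hk ▸ hn ▸ hc) (hn ▸ hl)
  · exact key hδ hn h h' hu₀ hu₁ hv₀ hv₁ hc hl

/-- If the step of each letter in one coding is turned by the word map `φ` and the change of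
coordinate `χ` into a stretch of an orbit in another coding, the same holds for all words. -/
lemma Follows.flatMap {C : Coding A} {D : Coding B} {φ : A → List B} {χ : ℤ → ℤ}
    (hφ : ∀ t u, C.ok t u → D.Follows (χ u) (φ t) ∧ χ u + D.disp (φ t) = χ (u + C.δ t))
    {l : List A} : ∀ {u : ℤ}, C.Follows u l →
    D.Follows (χ u) (l.flatMap φ) ∧ χ u + D.disp (l.flatMap φ) = χ (u + C.disp l) := by
  induction l with
  | nil => intro u _; simp
  | cons t l ih =>
    intro u h
    obtain ⟨h₁, h₂⟩ := hφ t u h.1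
    obtain ⟨h₃, h₄⟩ := ih h.2
    rw [List.flatMap_cons, follows_append, disp_append, h₂, disp_cons, ← add_assoc, ← add_assoc, h₂]
    exact ⟨⟨h₁, h₃⟩, h₄⟩

lemma Follows.map {C : Coding A} {D : Coding B} {φ : A → B} {χ : ℤ → ℤ}
    (hφ : ∀ t u, C.ok t u → D.ok (φ t) (χ u) ∧ χ u + D.δ (φ t) = χ (u + C.δ t))
    {l : List A} {u : ℤ} (h : C.Follows u l) :
    D.Follows (χ u) (l.map φ) ∧ χ u + D.disp (l.map φ) = χ (u + C.disp l) := by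
  have := Follows.flatMap (D := D) (φ := fun t => [φ t]) (χ := χ)
    (fun t u ht => by simpa using hφ t u ht) h
  simpa [List.map_eq_flatMap] using this

/-- Reading backwards: if `χ` turns each step of `C` into a reversed step of `D`, the reversed
words are read in `D`. -/
lemma Follows.reverse {C D : Coding A} {χ : ℤ → ℤ}
    (hφ : ∀ t u, C.ok t u → D.ok t (χ (u + C.δ t)) ∧ χ (u + C.δ t) + D.δ t = χ u)
    {l : List A} : ∀ {u : ℤ}, C.Follows u l →
    D.Follows (χ (u + C.disp l)) l.reverse ∧ χ (u + C.disp l) + D.disp l.reverse = χ u := by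
  induction l with
  | nil => intro u _; simp
  | cons t l ih =>
    intro u h
    obtain ⟨h₁, h₂⟩ := hφ t u h.1
    obtain ⟨h₃, h₄⟩ := ih h.2
    rw [List.reverse_cons, follows_append, disp_append, disp_cons, ← add_assoc]
    refine ⟨⟨h₃, by rw [h₄]; simpa using h₁⟩, ?_⟩
    rw [← add_assoc, h₄]
    simpa using h₂

/-- Two closed orbits of full length in the same coding are rotations of each other. -/
lemma Follows.isRotated {C : Coding A} {l l' : List A} {u u' : ℤ} (h : C.Follows u l)
    (h' : C.Follows u' l') (hu₀ : 0 ≤ u) (hu₁ : u < C.n) (hu'₀ : 0 ≤ u') (hu'₁ : u' < C.n)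
    (hk : IsCoprime C.k C.n) (hl : (l.length : ℤ) = C.n) (hl' : (l'.length : ℤ) = C.n)
    (hd : C.disp l = 0) : l ~r l' := by
  obtain ⟨l₁, l₂, rfl, rfl⟩ := h.exists_append hu₀ hu₁ hk hl hu'₀ hu'₁
  have h₁ := (follows_append C l₁ l₂ u).mp h
  have h₂ : C.Follows (u + C.disp l₁) (l₂ ++ l₁) := by
    rw [follows_append]
    refine ⟨h₁.2, ?_⟩
    rw [disp_append] at hd
    rw [add_assoc, hd, add_zero]
    exact h₁.1
  rw [← h₂.eq_of_length_eq h' (by rw [List.length_append] at *; omega)]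
  exact List.isRotated_append

/-- A rotation of a closed orbit is a closed orbit. -/
lemma Follows.of_isRotated {C : Coding A} {l l' : List A} {u : ℤ} (h : C.Follows u l)
    (hd : C.disp l = 0) (hr : l ~r l') (h₀ : 0 ≤ u) (h₁ : u < C.n) :
    ∃ v, 0 ≤ v ∧ v < C.n ∧ C.Follows v l' := by
  obtain ⟨l₁, l₂, rfl, rfl⟩ : ∃ l₁ l₂, l = l₁ ++ l₂ ∧ l' = l₂ ++ l₁ := by
    obtain ⟨m, hm, rfl⟩ := List.isRotated_iff_mod.mp hr
    exact ⟨l.take m, l.drop m, (List.take_append_drop _ _).symm, List.rotate_eq_drop_append_take hm⟩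
  have h₂ := (follows_append C l₁ l₂ u).mp h
  refine ⟨u + C.disp l₁, (h₂.1.range h₀ h₁).1, (h₂.1.range h₀ h₁).2, ?_⟩
  rw [follows_append]
  rw [disp_append] at hd
  refine ⟨h₂.2, ?_⟩
  rw [add_assoc, hd, add_zero]
  exact h₂.1

end Coding

/-! ### Special Sturmian morphisms -/

/-- The exchange of the intervals `[0, h)` and `[h, h + k)`: from a point below `h` the letter `x`
moves up by `k`, from the other points the letter `y` moves down by `h`. -/
def twoCoding (h k : ℕ) : Coding Two where
  n := h + k
  k := k
  δ := fun t => match t with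
    | Two.x => k
    | Two.y => -h
  ok := fun t u => match t with
    | Two.x => 0 ≤ u ∧ u < h
    | Two.y => h ≤ u ∧ u < h + k
  ok_left := by rintro (_ | _) u h <;> simp only at h <;> omega
  ok_right := by rintro (_ | _) u h <;> simp only at h ⊢ <;> omega
  ok_unique := by rintro (_ | _) (_ | _) u h h' <;> first | rfl | (simp only at h h'; omega)
  ok_exists := by
    intro u h₀ h₁
    rcases lt_or_ge u h with hu | hu
    · exact ⟨Two.x, h₀, hu⟩
    · exact ⟨Two.y, hu, h₁⟩
  step_congr := by
    rintro (_ | _)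
    · simp
    · exact ⟨-1, by ring⟩

@[simp] lemma twoCoding_n (h k : ℕ) : (twoCoding h k).n = h + k := rfl

@[simp] lemma twoCoding_k (h k : ℕ) : (twoCoding h k).k = k := rfl

@[simp] lemma twoCoding_δ_x (h k : ℕ) : (twoCoding h k).δ Two.x = k := rfl

@[simp] lemma twoCoding_δ_y (h k : ℕ) : (twoCoding h k).δ Two.y = -h := rfl

@[simp] lemma twoCoding_ok_x (h k : ℕ) (u : ℤ) :
    (twoCoding h k).ok Two.x u ↔ 0 ≤ u ∧ u < h := Iff.rfl

@[simp] lemma twoCoding_ok_y (h k : ℕ) (u : ℤ) :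
    (twoCoding h k).ok Two.y u ↔ h ≤ u ∧ u < h + k := Iff.rfl

lemma twoCoding_disp (h k : ℕ) (l : List Two) :
    (twoCoding h k).disp l = k * l.count Two.x - h * l.count Two.y := by
  induction l with
  | nil => simp
  | cons t l ih =>
    rcases t with _ | _ <;> simp [ih] <;> ring

lemma length_eq_count_two (l : List Two) : l.length = l.count Two.x + l.count Two.y := by
  induction l with
  | nil => rfl
  | cons t l ih => rcases t with _ | _ <;> simp [ih] <;> ring

@[simp] lemma subst2_x (u v : FreeMonoid Two) : subst2 u v (word Two.x) = u :=
  FreeMonoid.lift_eval_of _ _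

@[simp] lemma subst2_y (u v : FreeMonoid Two) : subst2 u v (word Two.y) = v :=
  FreeMonoid.lift_eval_of _ _

lemma toList_lift {A B : Type} (φ : A → FreeMonoid B) (w : FreeMonoid A) :
    (FreeMonoid.lift φ w).toList = w.toList.flatMap (fun t => (φ t).toList) := by
  rw [FreeMonoid.lift_apply, FreeMonoid.toList_prod, List.map_map, List.flatMap_def]
  rfl

lemma toList_subst2 (u v w : FreeMonoid Two) :
    (subst2 u v w).toList = w.toList.flatMap (fun t => match t with
      | Two.x => u.toList
      | Two.y => v.toList) := by
  refine (toList_lift _ w).trans ?_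
  congr 1

lemma subst2_ext {f g : Subst2} (hx : (f (word Two.x)).toList = (g (word Two.x)).toList)
    (hy : (f (word Two.y)).toList = (g (word Two.y)).toList) : f = g := by
  apply FreeMonoid.hom_eq
  rintro (_ | _)
  · exact FreeMonoid.toList.injective hx
  · exact FreeMonoid.toList.injective hy

lemma count_subst2 (u v w : FreeMonoid Two) (t : Two) :
    (subst2 u v w).toList.count t =
      w.toList.count Two.x * u.toList.count t + w.toList.count Two.y * v.toList.count t := by
  induction w using FreeMonoid.inductionOn' with
  | one => simp
  | of_mul s w ih =>
    rw [map_mul, FreeMonoid.toList_mul, List.count_append, ih, FreeMonoid.toList_of_mul]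
    rcases s with _ | _
    · change List.count t (subst2 u v (word Two.x)).toList + _ = _
      rw [subst2_x]; simp; ring
    · change List.count t (subst2 u v (word Two.y)).toList + _ = _
      rw [subst2_y]; simp; ring

/-- The word `f(xy)` is the orbit of length `h + k` that starts at `s` in the exchange of two
intervals of lengths `h` and `k`, and the divider stands where this orbit reaches `s + 1`. -/
structure SturmCoded (h k : ℕ) (s : ℤ) (f : Subst2) : Prop where
  nonneg : 0 ≤ s
  lt : s + 1 < h + k
  fx : (twoCoding h k).Follows s (f (word Two.x)).toList
  dx : (twoCoding h k).disp (f (word Two.x)).toList = 1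
  fy : (twoCoding h k).Follows (s + 1) (f (word Two.y)).toList
  dy : (twoCoding h k).disp (f (word Two.y)).toList = -1
  count_x : (f (word Two.x)).toList.count Two.x + (f (word Two.y)).toList.count Two.x = h
  count_y : (f (word Two.x)).toList.count Two.y + (f (word Two.y)).toList.count Two.y = k

lemma sturmCoded_one : SturmCoded 1 1 0 1 where
  nonneg := le_rfl
  lt := by simp
  fx := by simp [word]
  dx := by simp [word]
  fy := by simp [word]
  dy := by simp [word]
  count_x := by simp [word]
  count_y := by simp [word]

/-- Composition with a substitution `φ` that refines the orbits of the exchange of `h` and `k` to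
orbits of the exchange of `h'` and `k'`, after a translation by `e`. -/
lemma SturmCoded.mul {h k h' k' : ℕ} {s e : ℤ} {u v : FreeMonoid Two} {f : Subst2}
    (H : SturmCoded h k s f) (he : 0 ≤ e) (hlt : h + k + e ≤ h' + k')
    (hh : h' = h * u.toList.count Two.x + k * v.toList.count Two.x)
    (hk : k' = h * u.toList.count Two.y + k * v.toList.count Two.y)
    (hu : ∀ p : ℤ, 0 ≤ p → p < h → (twoCoding h' k').Follows (p + e) u.toList)
    (hv : ∀ p : ℤ, h ≤ p → p < h + k → (twoCoding h' k').Follows (p + e) v.toList)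
    (du : (twoCoding h' k').disp u.toList = k) (dv : (twoCoding h' k').disp v.toList = -h) :
    SturmCoded h' k' (s + e) (subst2 u v * f) := by
  have key : ∀ (w : FreeMonoid Two) (p : ℤ), (twoCoding h k).Follows p w.toList →
      (twoCoding h' k').Follows (p + e) (subst2 u v w).toList ∧
      p + e + (twoCoding h' k').disp (subst2 u v w).toList =
        p + (twoCoding h k).disp w.toList + e := by
    intro w p hw
    rw [toList_subst2]
    refine Coding.Follows.flatMap (D := twoCoding h' k') (χ := fun p => p + e) ?_ hw
    rintro (_ | _) q hq
    · exact ⟨hu q hq.1 hq.2, by simp only [du, twoCoding_δ_x]; ring⟩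
    · exact ⟨hv q hq.1 hq.2, by simp only [dv, twoCoding_δ_y]; ring⟩
  have hX := key _ _ H.fx
  have hY := key _ _ H.fy
  have cx := H.count_x
  have cy := H.count_y
  refine ⟨by linarith [H.nonneg], by linarith [H.lt], hX.1, ?_, ?_, ?_, ?_, ?_⟩
  · have := hX.2
    rw [H.dx] at this
    change (twoCoding h' k').disp (subst2 u v (f (word Two.x))).toList = 1
    linarith
  · have := hY.1
    rw [add_right_comm] at this
    exact this
  · have := hY.2
    rw [H.dy] at this
    change (twoCoding h' k').disp (subst2 u v (f (word Two.y))).toList = -1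
    linarith
  · change List.count _ (subst2 u v (f (word Two.x))).toList +
      List.count _ (subst2 u v (f (word Two.y))).toList = h'
    rw [count_subst2, count_subst2, hh, ← cx, ← cy]
    ring
  · change List.count _ (subst2 u v (f (word Two.x))).toList +
      List.count _ (subst2 u v (f (word Two.y))).toList = k'
    rw [count_subst2, count_subst2, hk, ← cx, ← cy]
    ring

/-- Each generator refines the exchange by one Euclidean step: the orbit of the old exchange is the
orbit of the new one induced on its lowest or its highest points. -/
lemma SturmCoded.morG_mul {h k : ℕ} {s : ℤ} {f : Subst2} (H : SturmCoded h k s f) :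
    SturmCoded (h + k) k s (morG * f) := by
  have := H.mul (h' := h + k) (k' := k) (e := 0) (u := word Two.x) (v := word Two.x * word Two.y)
    le_rfl (by push_cast; omega) (by simp [word]) (by simp [word])
    (fun p _ _ => by simp [word]; omega)
    (fun p _ _ => by simp [word]; omega) (by simp [word]) (by simp [word])
  rwa [add_zero] at this

lemma SturmCoded.morGt_mul {h k : ℕ} {s : ℤ} {f : Subst2} (H : SturmCoded h k s f) :
    SturmCoded (h + k) k (s + k) (morGt * f) :=
  H.mul (h' := h + k) (k' := k) (u := word Two.x) (v := word Two.y * word Two.x)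
    (by omega) (by push_cast; omega) (by simp [word]) (by simp [word])
    (fun p _ _ => by simp [word]; omega)
    (fun p _ _ => by simp [word]; omega) (by simp [word]) (by simp [word])

lemma SturmCoded.morD_mul {h k : ℕ} {s : ℤ} {f : Subst2} (H : SturmCoded h k s f) :
    SturmCoded h (h + k) (s + h) (morD * f) :=
  H.mul (h' := h) (k' := h + k) (u := word Two.y * word Two.x) (v := word Two.y)
    (by omega) (by push_cast; omega) (by simp [word]) (by simp [word])
    (fun p _ _ => by simp [word]; omega)
    (fun p _ _ => by simp [word]; omega) (by simp [word]) (by simp [word])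

lemma SturmCoded.morDt_mul {h k : ℕ} {s : ℤ} {f : Subst2} (H : SturmCoded h k s f) :
    SturmCoded h (h + k) s (morDt * f) := by
  have := H.mul (h' := h) (k' := h + k) (e := 0) (u := word Two.x * word Two.y) (v := word Two.y)
    le_rfl (by push_cast; omega) (by simp [word]) (by simp [word])
    (fun p _ _ => by simp [word]; omega)
    (fun p _ _ => by simp [word]; omega) (by simp [word]) (by simp [word])
  rwa [add_zero] at this

lemma exists_sturmCoded {f : Subst2} (hf : f ∈ specialSturmian) :
    ∃ h k s, SturmCoded h k s f := by
  refine Submonoid.closure_induction_left (motive := fun f _ => ∃ h k s, SturmCoded h k s f)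
    ⟨1, 1, 0, sturmCoded_one⟩ ?_ hf
  rintro g (rfl | rfl | rfl | rfl) f - ⟨h, k, s, H⟩
  · exact ⟨_, _, _, H.morG_mul⟩
  · exact ⟨_, _, _, H.morGt_mul⟩
  · exact ⟨_, _, _, H.morD_mul⟩
  · exact ⟨_, _, _, H.morDt_mul⟩

lemma exists_sturmCoded_of_standard {f : Subst2} (hf : f ∈ specialStandard) :
    ∃ h k : ℕ, SturmCoded h k (k - 1) f := by
  refine Submonoid.closure_induction_left
    (motive := fun f _ => ∃ h k : ℕ, SturmCoded h k (k - 1) f)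
    ⟨1, 1, by simpa using sturmCoded_one⟩ ?_ hf
  rintro g (rfl | rfl) f - ⟨h, k, H⟩
  · exact ⟨_, _, H.morG_mul⟩
  · refine ⟨h, h + k, ?_⟩
    have := H.morD_mul
    have e : ((h + k : ℕ) : ℤ) - 1 = k - 1 + h := by push_cast; ring
    rwa [e]

/-- By the Euclidean algorithm, all coprime lengths and all admissible starting points occur. -/
lemma exists_mem_specialSturmian_sturmCoded (N : ℕ) : ∀ {h k : ℕ} {s : ℤ}, h + k = N → 0 < h →
    0 < k → Nat.Coprime h k → 0 ≤ s → s + 1 < h + k →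
    ∃ f, SturmCoded h k s f ∧ f ∈ specialSturmian ∧ (s = k - 1 → f ∈ specialStandard) := by
  induction N using Nat.strong_induction_on with
  | _ N ih =>
  intro h k s hN hh hk hc h₀ h₁
  have gen : ∀ g : Subst2, g = morG ∨ g = morGt ∨ g = morD ∨ g = morDt → g ∈ specialSturmian := by
    intro g hg
    exact Submonoid.subset_closure (by simpa using hg)
  rcases lt_trichotomy h k with hlt | rfl | hlt
  · obtain ⟨j, rfl⟩ := Nat.exists_eq_add_of_lt hlt
    have hc' : Nat.Coprime h (j + 1) := by
      rw [add_assoc] at hc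
      exact (Nat.coprime_add_self_right).mp (by rwa [add_comm] at hc)
    by_cases hs : (h : ℤ) ≤ s
    · obtain ⟨f, H, hf, hst⟩ := ih (h + (j + 1)) (by omega) (h := h) (k := j + 1) (s := s - h) rfl
        hh (by omega) hc' (by omega) (by push_cast at *; omega)
      refine ⟨morD * f, ?_, mul_mem (gen _ (by simp)) hf, fun e => ?_⟩
      · have := H.morD_mul
        rwa [sub_add_cancel] at this
      · exact mul_mem (Submonoid.subset_closure (by simp)) (hst (by push_cast at *; omega))
    · obtain ⟨f, H, hf, hst⟩ := ih (h + (j + 1)) (by omega) (h := h) (k := j + 1) (s := s) rfl hh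
        (by omega) hc' h₀ (by push_cast at *; omega)
      refine ⟨morDt * f, H.morDt_mul, mul_mem (gen _ (by simp)) hf, fun e => ?_⟩
      push_cast at *
      omega
  · obtain rfl : h = 1 := (Nat.coprime_self h).mp hc
    obtain rfl : s = 0 := by push_cast at h₁; omega
    exact ⟨1, sturmCoded_one, one_mem _, fun _ => one_mem _⟩
  · obtain ⟨j, rfl⟩ : ∃ j, h = j + 1 + k := ⟨h - k - 1, by omega⟩
    have hc' : Nat.Coprime (j + 1) k := (Nat.coprime_add_self_left).mp hc
    by_cases hs : s + 1 < ((j + 1 + k : ℕ) : ℤ)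
    · obtain ⟨f, H, hf, hst⟩ := ih (j + 1 + k) (by omega) (h := j + 1) (k := k) (s := s) rfl
        (by omega) hk hc' h₀ (by push_cast at *; omega)
      exact ⟨morG * f, H.morG_mul, mul_mem (gen _ (by simp)) hf,
        fun e => mul_mem (Submonoid.subset_closure (by simp)) (hst e)⟩
    · obtain ⟨f, H, hf, hst⟩ := ih (j + 1 + k) (by omega) (h := j + 1) (k := k) (s := s - k) rfl
        (by omega) hk hc' (by push_cast at *; omega) (by push_cast at *; omega)
      refine ⟨morGt * f, ?_, mul_mem (gen _ (by simp)) hf, fun e => ?_⟩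
      · have := H.morGt_mul
        rwa [sub_add_cancel] at this
      · push_cast at *
        omega

lemma SturmCoded.det {h k : ℕ} {s : ℤ} {f : Subst2} (H : SturmCoded h k s f) :
    (k : ℤ) * (f (word Two.x)).toList.count Two.x -
      h * (f (word Two.x)).toList.count Two.y = 1 := by
  rw [← twoCoding_disp]; exact H.dx

lemma SturmCoded.isCoprime {h k : ℕ} {s : ℤ} {f : Subst2} (H : SturmCoded h k s f) :
    IsCoprime (h : ℤ) k :=
  ⟨-(f (word Two.x)).toList.count Two.y, (f (word Two.x)).toList.count Two.x, by
    linear_combination H.det⟩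

lemma SturmCoded.isCoprime_k_n {h k : ℕ} {s : ℤ} {f : Subst2} (H : SturmCoded h k s f) :
    IsCoprime (twoCoding h k).k (twoCoding h k).n := by
  have := H.isCoprime.symm.add_mul_left_right 1
  rwa [mul_one] at this

lemma SturmCoded.pos {h k : ℕ} {s : ℤ} {f : Subst2} (H : SturmCoded h k s f) : 0 < h ∧ 0 < k := by
  have h₁ := H.det
  have h₂ := H.dy
  rw [twoCoding_disp] at h₂
  constructor
  · rcases Nat.eq_zero_or_pos h with rfl | h
    · have h₃ : (0 : ℤ) ≤ k * (f (word Two.y)).toList.count Two.x := by positivity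
      simp only [Nat.cast_zero, zero_mul] at h₂
      omega
    · exact h
  · rcases Nat.eq_zero_or_pos k with rfl | h
    · have h₃ : (0 : ℤ) ≤ h * (f (word Two.x)).toList.count Two.y := by positivity
      simp only [Nat.cast_zero, zero_mul] at h₁
      omega
    · exact h

/-- The equation `k p - h r = 1` has at most one solution with `1 ≤ p ≤ h`. -/
lemma bezout_unique {h k p r p' r' : ℤ} (e : k * p - h * r = 1) (e' : k * p' - h * r' = 1)
    (hp : 0 < p) (hp' : 0 < p') (hph : p ≤ h) (hph' : p' ≤ h) : p = p' ∧ r = r' := by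
  have hc : IsCoprime h k := ⟨-r, p, by linear_combination e⟩
  have hd : h ∣ p - p' := by
    apply hc.dvd_of_dvd_mul_left
    exact ⟨r - r', by linear_combination e - e'⟩
  have h₀ : p - p' = 0 := by
    apply Int.eq_zero_of_abs_lt_dvd hd
    rw [abs_lt]; constructor <;> linarith
  have h₁ : p = p' := by linarith
  subst h₁
  refine ⟨rfl, ?_⟩
  have h₂ : h * (r - r') = 0 := by linear_combination e' - e
  rcases mul_eq_zero.mp h₂ with h₃ | h₃ <;> linarith

lemma SturmCoded.count_pos {h k : ℕ} {s : ℤ} {f : Subst2} (H : SturmCoded h k s f) :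
    0 < (f (word Two.x)).toList.count Two.x := by
  rcases Nat.eq_zero_or_pos ((f (word Two.x)).toList.count Two.x) with h₁ | h₁
  · have h₂ := H.det
    have h₃ : (0 : ℤ) ≤ h * (f (word Two.x)).toList.count Two.y := by positivity
    rw [h₁] at h₂
    simp only [Nat.cast_zero, mul_zero] at h₂
    omega
  · exact h₁

/-- The incidence matrix is determined by the two interval lengths. -/
lemma SturmCoded.incidence_eq {h k : ℕ} {s s' : ℤ} {f f' : Subst2} (H : SturmCoded h k s f)
    (H' : SturmCoded h k s' f') : incidence f = incidence f' := by
  have h₁ := H.count_pos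
  have h₁' := H'.count_pos
  have h₂ := H.count_x
  have h₂' := H'.count_x
  have h₃ := H.count_y
  have h₃' := H'.count_y
  have h₄ := bezout_unique H.det H'.det (by omega) (by omega) (by omega) (by omega)
  unfold incidence
  rw [show List.count Two.x (f (word Two.x)).toList = List.count Two.x (f' (word Two.x)).toList by
      omega,
    show List.count Two.y (f (word Two.x)).toList = List.count Two.y (f' (word Two.x)).toList by
      omega,
    show List.count Two.x (f (word Two.y)).toList = List.count Two.x (f' (word Two.y)).toList by
      omega,
    show List.count Two.y (f (word Two.y)).toList = List.count Two.y (f' (word Two.y)).toList by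
      omega]

lemma SturmCoded.ext {h k : ℕ} {s : ℤ} {f f' : Subst2} (H : SturmCoded h k s f)
    (H' : SturmCoded h k s f') : f = f' := by
  have hM := H.incidence_eq H'
  have h₁ := congrFun (congrFun hM 0) 0
  have h₂ := congrFun (congrFun hM 0) 1
  have h₃ := congrFun (congrFun hM 1) 0
  have h₄ := congrFun (congrFun hM 1) 1
  simp only [incidence, Matrix.of_apply, Matrix.cons_val', Matrix.cons_val_zero,
    Matrix.cons_val_one, Matrix.cons_val_fin_one] at h₁ h₂ h₃ h₄
  apply subst2_ext
  · exact H.fx.eq_of_length_eq H'.fx (by simp only [length_eq_count_two]; omega)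
  · exact H.fy.eq_of_length_eq H'.fy (by simp only [length_eq_count_two]; omega)

lemma SturmCoded.mem {h k : ℕ} {s : ℤ} {f : Subst2} (H : SturmCoded h k s f) :
    f ∈ specialSturmian ∧ (s = k - 1 → f ∈ specialStandard) := by
  obtain ⟨f', H', h₁⟩ := exists_mem_specialSturmian_sturmCoded (h + k) rfl H.pos.1 H.pos.2
    (Nat.isCoprime_iff_coprime.mp H.isCoprime) H.nonneg H.lt
  rwa [H.ext H']

lemma SturmCoded.follows_mul {h k : ℕ} {s : ℤ} {f : Subst2} (H : SturmCoded h k s f) :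
    (twoCoding h k).Follows s (f (word Two.x * word Two.y)).toList := by
  rw [map_mul, FreeMonoid.toList_mul, Coding.follows_append, H.dx]
  exact ⟨H.fx, H.fy⟩

lemma SturmCoded.length_mul {h k : ℕ} {s : ℤ} {f : Subst2} (H : SturmCoded h k s f) :
    (f (word Two.x * word Two.y)).toList.length = h + k := by
  rw [map_mul, FreeMonoid.toList_mul, List.length_append, length_eq_count_two, length_eq_count_two,
    ← H.count_x, ← H.count_y]
  ring

/-- The three data are determined by the morphism. -/
lemma SturmCoded.unique {h k h' k' : ℕ} {s s' : ℤ} {f : Subst2} (H : SturmCoded h k s f)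
    (H' : SturmCoded h' k' s' f) : h = h' ∧ k = k' ∧ s = s' := by
  obtain rfl : h = h' := H.count_x.symm.trans H'.count_x
  obtain rfl : k = k' := H.count_y.symm.trans H'.count_y
  have h₁ := H.lt
  have h₂ := H'.lt
  refine ⟨rfl, rfl, H.follows_mul.start_unique rfl rfl rfl H'.follows_mul H.nonneg (by simp; omega)
    H'.nonneg (by simp; omega) H.isCoprime_k_n (by rw [H.length_mul]; simp)⟩

/-! ### Authentic substitutions as orbits on three letters -/

/-- The exchange of the intervals `[0, α)` and `[α, α + 2β)` in which the upper interval is shared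
by two letters according to parity: `b` is read at the points `u` with `u + ε` odd, and `c` at
those with `u + ε` even. -/
def threeCoding (α β : ℕ) (ε : ℤ) : Coding Letter where
  n := α + 2 * β
  k := 2 * β
  δ := fun t => match t with
    | Letter.a => 2 * β
    | Letter.b => -α
    | Letter.c => -α
  ok := fun t u => match t with
    | Letter.a => 0 ≤ u ∧ u < α
    | Letter.b => α ≤ u ∧ u < α + 2 * β ∧ (u + ε) % 2 = 1
    | Letter.c => α ≤ u ∧ u < α + 2 * β ∧ (u + ε) % 2 = 0
  ok_left := by rintro (_ | _ | _) u h <;> simp only at h <;> omega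
  ok_right := by rintro (_ | _ | _) u h <;> simp only at h ⊢ <;> omega
  ok_unique := by
    rintro (_ | _ | _) (_ | _ | _) u h h' <;> first | rfl | (simp only at h h'; omega)
  ok_exists := by
    intro u h₀ h₁
    rcases lt_or_ge u α with hu | hu
    · exact ⟨Letter.a, h₀, hu⟩
    · rcases Int.emod_two_eq_zero_or_one (u + ε) with h | h
      · exact ⟨Letter.c, hu, h₁, h⟩
      · exact ⟨Letter.b, hu, h₁, h⟩
  step_congr := by
    rintro (_ | _ | _)
    · simp
    · exact ⟨-1, by ring⟩
    · exact ⟨-1, by ring⟩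

section

variable (α β : ℕ) (ε : ℤ)

@[simp] lemma threeCoding_n : (threeCoding α β ε).n = α + 2 * β := rfl

@[simp] lemma threeCoding_k : (threeCoding α β ε).k = 2 * β := rfl

@[simp] lemma threeCoding_δ_a : (threeCoding α β ε).δ Letter.a = 2 * β := rfl

@[simp] lemma threeCoding_δ_b : (threeCoding α β ε).δ Letter.b = -α := rfl

@[simp] lemma threeCoding_δ_c : (threeCoding α β ε).δ Letter.c = -α := rfl

@[simp] lemma threeCoding_ok_a (u : ℤ) :
    (threeCoding α β ε).ok Letter.a u ↔ 0 ≤ u ∧ u < α := Iff.rfl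

@[simp] lemma threeCoding_ok_b (u : ℤ) : (threeCoding α β ε).ok Letter.b u ↔
    α ≤ u ∧ u < α + 2 * β ∧ (u + ε) % 2 = 1 := Iff.rfl

@[simp] lemma threeCoding_ok_c (u : ℤ) : (threeCoding α β ε).ok Letter.c u ↔
    α ≤ u ∧ u < α + 2 * β ∧ (u + ε) % 2 = 0 := Iff.rfl

lemma threeCoding_disp (l : List Letter) : (threeCoding α β ε).disp l =
    2 * β * l.count Letter.a - α * (l.count Letter.b + l.count Letter.c) := by
  induction l with
  | nil => simp
  | cons t l ih => rcases t with _ | _ | _ <;> simp [ih] <;> ring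

end

lemma length_eq_count_three (l : List Letter) :
    l.length = l.count Letter.a + l.count Letter.b + l.count Letter.c := by
  induction l with
  | nil => rfl
  | cons t l ih => rcases t with _ | _ | _ <;> simp [ih] <;> ring

/-- The identification `b → c` of letters. -/
def letterBC : Letter → Two
  | Letter.a => Two.x
  | Letter.b => Two.y
  | Letter.c => Two.y

/-- The identification `a → b` of letters. -/
def letterAB : Letter → Two
  | Letter.a => Two.x
  | Letter.b => Two.x
  | Letter.c => Two.y

/-- The identification `c → a` of letters. -/
def letterCA : Letter → Two
  | Letter.a => Two.x
  | Letter.b => Two.y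
  | Letter.c => Two.x

attribute [simp] letterBC letterAB letterCA

lemma toList_piBC (w : FreeMonoid Letter) : (piBC w).toList = w.toList.map letterBC := by
  refine (FreeMonoid.toList_map _ _).trans ?_
  congr 1

lemma toList_piAB (w : FreeMonoid Letter) : (piAB w).toList = w.toList.map letterAB := by
  refine (FreeMonoid.toList_map _ _).trans ?_
  congr 1

lemma toList_piCA (w : FreeMonoid Letter) : (piCA w).toList = w.toList.map letterCA := by
  refine (FreeMonoid.toList_map _ _).trans ?_
  congr 1

lemma count_map_BC (l : List Letter) : (l.map letterBC).count Two.x = l.count Letter.a ∧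
    (l.map letterBC).count Two.y = l.count Letter.b + l.count Letter.c := by
  induction l with
  | nil => simp
  | cons t l ih => rcases t with _ | _ | _ <;> simp [ih] <;> ring

lemma count_map_AB (l : List Letter) :
    (l.map letterAB).count Two.x = l.count Letter.a + l.count Letter.b ∧
    (l.map letterAB).count Two.y = l.count Letter.c := by
  induction l with
  | nil => simp
  | cons t l ih => rcases t with _ | _ | _ <;> simp [ih] <;> ring

lemma count_map_CA (l : List Letter) :
    (l.map letterCA).count Two.x = l.count Letter.a + l.count Letter.c ∧
    (l.map letterCA).count Two.y = l.count Letter.b := by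
  induction l with
  | nil => simp
  | cons t l ih => rcases t with _ | _ | _ <;> simp [ih] <;> ring

/-- The image of the letter `t`, as a list. -/
def image (σ : Subst3) (t : Letter) : List Letter := (σ (word t)).toList

lemma modeWord_eq (σ : Subst3) :
    modeWord σ = image σ Letter.a ++ image σ Letter.b ++ image σ Letter.c := by
  simp [modeWord, image, map_mul, FreeMonoid.toList_mul]

lemma apotomic_x (σ : Subst3) :
    (apotomic σ (word Two.x)).toList = (image σ Letter.a).map letterBC := by
  rw [apotomic, subst2_x, toList_piBC, image]

lemma apotomic_y (σ : Subst3) : (apotomic σ (word Two.y)).toList =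
    (image σ Letter.b ++ image σ Letter.c).map letterBC := by
  rw [apotomic, subst2_y, toList_piBC, image, image, map_mul, FreeMonoid.toList_mul]

lemma apoSyntonic_x (σ : Subst3) : (apoSyntonic σ (word Two.x)).toList =
    (image σ Letter.a ++ image σ Letter.b).map letterAB := by
  rw [apoSyntonic, subst2_x, toList_piAB, image, image, map_mul, FreeMonoid.toList_mul]

lemma apoSyntonic_y (σ : Subst3) :
    (apoSyntonic σ (word Two.y)).toList = (image σ Letter.c).map letterAB := by
  rw [apoSyntonic, subst2_y, toList_piAB, image]

lemma syntonic_x (σ : Subst3) : (syntonic σ (word Two.x)).toList =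
    (image σ Letter.a ++ image σ Letter.b).map letterCA := by
  rw [syntonic, subst2_x, toList_piCA, image, image, map_mul, FreeMonoid.toList_mul]

lemma syntonic_y (σ : Subst3) :
    (syntonic σ (word Two.y)).toList = (image σ Letter.c).map letterCA := by
  rw [syntonic, subst2_y, toList_piCA, image]

lemma subst3_ext {σ τ : Subst3} (h : ∀ t, image σ t = image τ t) : σ = τ := by
  apply FreeMonoid.hom_eq
  exact fun t => FreeMonoid.toList.injective (h t)

/-- The word `σ(abc)` is a closed orbit of length `α + 2β` of `threeCoding α β ε`, and its two
dividers stand where the orbit, starting at `u`, reaches `u + 1` and `u + 2`. -/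
structure PWWFCoded (α β : ℕ) (u ε : ℤ) (σ : Subst3) : Prop where
  nonneg : 0 ≤ u
  lt : u + 2 < α + 2 * β
  odd : α % 2 = 1
  eps : ε = 0 ∨ ε = 1
  fa : (threeCoding α β ε).Follows u (image σ Letter.a)
  da : (threeCoding α β ε).disp (image σ Letter.a) = 1
  fb : (threeCoding α β ε).Follows (u + 1) (image σ Letter.b)
  db : (threeCoding α β ε).disp (image σ Letter.b) = 1
  fc : (threeCoding α β ε).Follows (u + 2) (image σ Letter.c)
  dc : (threeCoding α β ε).disp (image σ Letter.c) = -2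
  count_a : (modeWord σ).count Letter.a = α
  count_b : (modeWord σ).count Letter.b = β
  count_c : (modeWord σ).count Letter.c = β

/-- Three compatible orbits on two letters merge into one orbit on three letters. The positions `v`
and `z` of the orbits in which `c` and `b` are singled out differ by `d` or by `d - n`; the letter
`b` takes the second difference to the first, `c` does the opposite, and both change the parity
of `u`. -/
lemma follows_three {α β : ℕ} {d ε : ℤ} (hα : α % 2 = 1) (hd₀ : 0 < d) (hd₁ : d < α + 2 * β)
    {l : List Letter} : ∀ {u v z : ℤ},
    (twoCoding α (2 * β)).Follows u (l.map letterBC) →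
    (twoCoding (α + β) β).Follows v (l.map letterAB) →
    (twoCoding (α + β) β).Follows z (l.map letterCA) →
    (v - z = d ∧ (u + ε) % 2 = 0) ∨ (v - z = d - (α + 2 * β) ∧ (u + ε) % 2 = 1) →
    (threeCoding α β ε).Follows u l := by
  induction l with
  | nil => intros; trivial
  | cons t l ih =>
    rintro u v z ⟨h₁, h₁'⟩ ⟨h₂, h₂'⟩ ⟨h₃, h₃'⟩ h
    rcases t with _ | _ | _
    · simp at h₁ h₂ h₃
      refine ⟨⟨by omega, by omega⟩, ?_⟩
      refine ih (by simpa using h₁') h₂' h₃' ?_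
      simp
      omega
    · simp at h₁ h₂ h₃
      refine ⟨⟨by omega, by omega, by omega⟩, ?_⟩
      refine ih h₁' h₂' h₃' ?_
      simp
      omega
    · simp at h₁ h₂ h₃
      refine ⟨⟨by omega, by omega, by omega⟩, ?_⟩
      refine ih h₁' h₂' h₃' ?_
      simp
      omega

/-- The positions `v` and `z` differ as soon as `b` occurs: they change by the same amount at each
`a`, and where they agree neither `b` nor `c` is compatible with both orbits. -/
lemma count_b_eq_zero_of_same_position {α β : ℕ} {l : List Letter} : ∀ {v : ℤ},
    (twoCoding (α + β) β).Follows v (l.map letterAB) →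
    (twoCoding (α + β) β).Follows v (l.map letterCA) → l.count Letter.b = 0 := by
  induction l with
  | nil => intros; rfl
  | cons t l ih =>
    rintro v ⟨h₂, h₂'⟩ ⟨h₃, h₃'⟩
    rcases t with _ | _ | _
    · simpa using ih h₂' h₃'
    · simp at h₂ h₃; omega
    · simp at h₂ h₃; omega

/-- Two positive numbers below the modulus with a common inverse are equal. -/
lemma eq_of_common_inverse {a b c n L B C : ℤ} (hn : n = a + b + c) (ha : 0 < a) (hb : 0 < b)
    (hc : 0 < c) (e : c * L - C * n = 1) (e' : b * L - B * n = 1) : b = c := by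
  have hcop : IsCoprime n L := ⟨-C, c, by linear_combination e⟩
  have hd : n ∣ c - b := by
    apply hcop.dvd_of_dvd_mul_right
    exact ⟨C - B, by linear_combination e - e'⟩
  have : c - b = 0 := by
    apply Int.eq_zero_of_abs_lt_dvd hd
    rw [abs_lt]; constructor <;> linarith
  linarith

lemma twoCoding_disp_BC (h k : ℕ) (l : List Letter) : (twoCoding h k).disp (l.map letterBC) =
    k * l.count Letter.a - h * (l.count Letter.b + l.count Letter.c) := by
  rw [twoCoding_disp, (count_map_BC l).1, (count_map_BC l).2]
  push_cast
  ring

lemma twoCoding_disp_AB (h k : ℕ) (l : List Letter) : (twoCoding h k).disp (l.map letterAB) =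
    k * (l.count Letter.a + l.count Letter.b) - h * l.count Letter.c := by
  rw [twoCoding_disp, (count_map_AB l).1, (count_map_AB l).2]
  push_cast
  ring

lemma twoCoding_disp_CA (h k : ℕ) (l : List Letter) : (twoCoding h k).disp (l.map letterCA) =
    k * (l.count Letter.a + l.count Letter.c) - h * l.count Letter.b := by
  rw [twoCoding_disp, (count_map_CA l).1, (count_map_CA l).2]
  push_cast
  ring

/-- An authentic substitution is coded by an orbit on three letters. -/
lemma IsAuthentic.exists_coded {σ : Subst3} (h : IsAuthentic σ) :
    ∃ α β u ε, PWWFCoded α β u ε σ := by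
  obtain ⟨⟨h₁, k₁, u, F⟩, ⟨h₂, k₂, v, G⟩, ⟨h₃, k₃, z, S⟩⟩ :=
    And.intro (exists_sturmCoded h.1)
      (And.intro (exists_sturmCoded h.2.1) (exists_sturmCoded h.2.2))
  set X := image σ Letter.a with hX
  set Y := image σ Letter.b with hY
  set Z := image σ Letter.c with hZ
  obtain ⟨α, hα⟩ : ∃ m, m = (X ++ Y ++ Z).count Letter.a := ⟨_, rfl⟩
  obtain ⟨β, hβ⟩ : ∃ m, m = (X ++ Y ++ Z).count Letter.b := ⟨_, rfl⟩
  obtain ⟨γ, hγ⟩ : ∃ m, m = (X ++ Y ++ Z).count Letter.c := ⟨_, rfl⟩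
  have Fx := F.count_x
  have Fy := F.count_y
  have Gx := G.count_x
  have Gy := G.count_y
  have Sx := S.count_x
  have Sy := S.count_y
  rw [apotomic_x, apotomic_y, ← hX, ← hY, ← hZ] at Fx Fy
  rw [apoSyntonic_x, apoSyntonic_y, ← hX, ← hY, ← hZ] at Gx Gy
  rw [syntonic_x, syntonic_y, ← hX, ← hY, ← hZ] at Sx Sy
  rw [(count_map_BC _).1, (count_map_BC _).1] at Fx
  rw [(count_map_BC _).2, (count_map_BC _).2] at Fy
  rw [(count_map_AB _).1, (count_map_AB _).1] at Gx
  rw [(count_map_AB _).2, (count_map_AB _).2] at Gy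
  rw [(count_map_CA _).1, (count_map_CA _).1] at Sx
  rw [(count_map_CA _).2, (count_map_CA _).2] at Sy
  simp only [List.count_append] at hα hβ hγ Fx Fy Gx Gy Sx Sy
  obtain rfl : h₁ = α := by omega
  obtain rfl : k₁ = β + γ := by omega
  obtain rfl : h₂ = h₁ + β := by omega
  obtain rfl : k₂ = γ := by omega
  obtain rfl : h₃ = h₁ + k₂ := by omega
  obtain rfl : k₃ = β := by omega
  rename' h₁ => α, k₂ => γ, k₃ => β
  have dF := F.dx
  have dG := G.dx
  have dS := S.dx
  rw [apotomic_x, ← hX] at dF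
  rw [apoSyntonic_x, ← hX, ← hY] at dG
  rw [syntonic_x, ← hX, ← hY] at dS
  have dG' := dG
  have dS' := dS
  rw [twoCoding_disp_AB] at dG'
  rw [twoCoding_disp_CA] at dS'
  have hβγ : (β : ℤ) = γ := by
    refine eq_of_common_inverse (a := α) (n := α + β + γ)
      (L := (X ++ Y).count Letter.a + (X ++ Y).count Letter.b + (X ++ Y).count Letter.c)
      (C := (X ++ Y).count Letter.c) (B := (X ++ Y).count Letter.b) rfl ?_ ?_ ?_ ?_ ?_
    · exact_mod_cast F.pos.1
    · exact_mod_cast S.pos.2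
    · exact_mod_cast G.pos.2
    · push_cast at dG' ⊢
      linear_combination dG'
    · push_cast at dS' ⊢
      linear_combination dS'
  obtain rfl : β = γ := by exact_mod_cast hβγ
  rw [← two_mul] at F dF
  have hodd : α % 2 = 1 := by
    have := dF
    rw [twoCoding_disp_BC] at this
    by_contra hne
    obtain ⟨j, rfl⟩ : ∃ j, α = 2 * j := ⟨α / 2, by omega⟩
    push_cast at this
    have h₂ : (2 : ℤ) * (β * X.count Letter.a - j * (X.count Letter.b + X.count Letter.c)) = 1 := by
      linear_combination this
    omega
  have fF : (twoCoding α (2 * β)).Follows u ((X ++ Y ++ Z).map letterBC) := by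
    have := F.follows_mul
    rw [map_mul, FreeMonoid.toList_mul, apotomic_x, apotomic_y, ← List.map_append] at this
    rwa [List.append_assoc]
  have fG : (twoCoding (α + β) β).Follows v ((X ++ Y ++ Z).map letterAB) := by
    have := G.follows_mul
    rwa [map_mul, FreeMonoid.toList_mul, apoSyntonic_x, apoSyntonic_y, ← List.map_append] at this
  have fS : (twoCoding (α + β) β).Follows z ((X ++ Y ++ Z).map letterCA) := by
    have := S.follows_mul
    rwa [map_mul, FreeMonoid.toList_mul, syntonic_x, syntonic_y, ← List.map_append] at this
  have hu := F.nonneg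
  have hu' := F.lt
  have hv := G.nonneg
  have hv' := G.lt
  have hz := S.nonneg
  have hz' := S.lt
  push_cast at hu' hv' hz'
  have hvz : v ≠ z := by
    rintro rfl
    have := count_b_eq_zero_of_same_position fG fS
    simp only [List.count_append] at this
    have := S.pos.2
    omega
  obtain ⟨ε, hε, hf⟩ : ∃ ε : ℤ, (ε = 0 ∨ ε = 1) ∧
      (threeCoding α β ε).Follows u (X ++ Y ++ Z) := by
    rcases lt_or_gt_of_ne hvz with hlt | hlt
    · refine ⟨(u + 1) % 2, by omega, ?_⟩
      exact follows_three (d := v - z + (α + 2 * β)) hodd (by omega) (by omega) fF fG fS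
        (Or.inr ⟨by ring, by omega⟩)
    · refine ⟨u % 2, by omega, ?_⟩
      exact follows_three (d := v - z) hodd (by omega) (by omega) fF fG fS
        (Or.inl ⟨by ring, by omega⟩)
  have dX : (threeCoding α β ε).disp X = 1 := by
    rw [twoCoding_disp_BC] at dF
    rw [threeCoding_disp]
    push_cast at dF
    linarith
  -- the translation of the first orbit is the sum of those of the two others
  have dXY : (threeCoding α β ε).disp (X ++ Y) = 2 := by
    rw [threeCoding_disp]
    push_cast at dG' dS'
    linear_combination dG' + dS'
  have dY : (threeCoding α β ε).disp Y = 1 := by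
    rw [Coding.disp_append] at dXY
    linarith
  have dXYZ : (threeCoding α β ε).disp (X ++ Y ++ Z) = 0 := by
    have ha : (X ++ Y ++ Z).count Letter.a = α := by simp only [List.count_append]; omega
    have hb : (X ++ Y ++ Z).count Letter.b = β := by simp only [List.count_append]; omega
    have hc : (X ++ Y ++ Z).count Letter.c = β := by simp only [List.count_append]; omega
    rw [threeCoding_disp, ha, hb, hc]
    ring
  have f₁ := (Coding.follows_append _ _ _ _).mp hf
  have f₂ := (Coding.follows_append _ _ _ _).mp f₁.1
  rw [dX] at f₂
  rw [dXY] at f₁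
  have hr := f₁.1.range hu (by simp; omega)
  rw [dXY] at hr
  refine ⟨α, β, u, ε, hu, hr.2, hodd, hε, f₂.1, dX, f₂.2, dY, f₁.2, ?_, ?_, ?_, ?_⟩
  · rw [Coding.disp_append, dXY] at dXYZ
    linarith
  all_goals
    rw [modeWord_eq, ← hX, ← hY, ← hZ]
    simp only [List.count_append]
    omega

/-! ### From orbits on three letters to authentic substitutions -/

/-- The change of coordinate from `threeCoding α β ε`, with `n = α + 2β` odd, to the exchange of two
intervals that singles out the letter read at the points `u` with `u + ε` odd: up to a
constant, the half of `u` modulo `n`. -/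
def halve (n ε u : ℤ) : ℤ := if (u + ε) % 2 = 1 then (u + n - ε) / 2 else (u - ε) / 2

lemma halve_add_two (n ε u : ℤ) : halve n ε (u + 2) = halve n ε u + 1 := by
  unfold halve
  split_ifs <;> omega

lemma halve_range {n ε u : ℤ} (hn : n % 2 = 1) (hε : ε = 0 ∨ ε = 1) (h₀ : 0 ≤ u)
    (h₁ : u + 2 < n) : 0 ≤ halve n ε u ∧ halve n ε u + 1 < n := by
  unfold halve
  split_ifs <;> omega

lemma Coding.Follows.letterCA {α β : ℕ} {ε u : ℤ} {l : List Letter} (hα : α % 2 = 1)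
    (hε : ε = 0 ∨ ε = 1) (h : (threeCoding α β ε).Follows u l) :
    (twoCoding (α + β) β).Follows (halve (α + 2 * β) ε u) (l.map _root_.letterCA) ∧
    halve (α + 2 * β) ε u + (twoCoding (α + β) β).disp (l.map _root_.letterCA) =
      halve (α + 2 * β) ε (u + (threeCoding α β ε).disp l) := by
  refine Coding.Follows.map (χ := halve (α + 2 * β) ε) ?_ h
  rintro (_ | _ | _) w hw <;> simp at hw ⊢ <;> unfold halve <;> split_ifs <;> omega

lemma Coding.Follows.letterAB {α β : ℕ} {ε u : ℤ} {l : List Letter} (hα : α % 2 = 1)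
    (hε : ε = 0 ∨ ε = 1) (h : (threeCoding α β ε).Follows u l) :
    (twoCoding (α + β) β).Follows (halve (α + 2 * β) (1 - ε) u) (l.map _root_.letterAB) ∧
    halve (α + 2 * β) (1 - ε) u + (twoCoding (α + β) β).disp (l.map _root_.letterAB) =
      halve (α + 2 * β) (1 - ε) (u + (threeCoding α β ε).disp l) := by
  refine Coding.Follows.map (χ := halve (α + 2 * β) (1 - ε)) ?_ h
  rintro (_ | _ | _) w hw <;> simp at hw ⊢ <;> unfold halve <;> split_ifs <;> omega

lemma Coding.Follows.letterBC {α β : ℕ} {ε u : ℤ} {l : List Letter}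
    (h : (threeCoding α β ε).Follows u l) :
    (twoCoding α (2 * β)).Follows u (l.map _root_.letterBC) ∧
    u + (twoCoding α (2 * β)).disp (l.map _root_.letterBC) = u + (threeCoding α β ε).disp l := by
  refine Coding.Follows.map (χ := id) ?_ h
  rintro (_ | _ | _) w hw <;> simp at hw ⊢ <;> omega

namespace PWWFCoded

variable {α β : ℕ} {u ε : ℤ} {σ : Subst3}

lemma count_add (H : PWWFCoded α β u ε σ) :
    (image σ Letter.a).count Letter.a + (image σ Letter.b).count Letter.a +
      (image σ Letter.c).count Letter.a = α ∧
    (image σ Letter.a).count Letter.b + (image σ Letter.b).count Letter.b +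
      (image σ Letter.c).count Letter.b = β ∧
    (image σ Letter.a).count Letter.c + (image σ Letter.b).count Letter.c +
      (image σ Letter.c).count Letter.c = β := by
  have h₁ := H.count_a
  have h₂ := H.count_b
  have h₃ := H.count_c
  rw [modeWord_eq] at h₁ h₂ h₃
  simp only [List.count_append] at h₁ h₂ h₃
  exact ⟨h₁, h₂, h₃⟩

lemma follows_ab (H : PWWFCoded α β u ε σ) :
    (threeCoding α β ε).Follows u (image σ Letter.a ++ image σ Letter.b) := by
  rw [Coding.follows_append, H.da]
  exact ⟨H.fa, H.fb⟩

lemma disp_ab (H : PWWFCoded α β u ε σ) :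
    (threeCoding α β ε).disp (image σ Letter.a ++ image σ Letter.b) = 2 := by
  rw [Coding.disp_append, H.da, H.db]
  norm_num

lemma follows_modeWord (H : PWWFCoded α β u ε σ) :
    (threeCoding α β ε).Follows u (modeWord σ) := by
  rw [modeWord_eq, Coding.follows_append, H.disp_ab]
  exact ⟨H.follows_ab, H.fc⟩

lemma disp_modeWord (H : PWWFCoded α β u ε σ) : (threeCoding α β ε).disp (modeWord σ) = 0 := by
  rw [modeWord_eq, Coding.disp_append, H.disp_ab, H.dc]
  norm_num

lemma length_modeWord (H : PWWFCoded α β u ε σ) : (modeWord σ).length = α + 2 * β := by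
  rw [length_eq_count_three, H.count_a, H.count_b, H.count_c]
  ring

lemma sturmCoded_apotomic (H : PWWFCoded α β u ε σ) :
    SturmCoded α (2 * β) u (apotomic σ) := by
  have h₁ := H.fa.letterBC
  have h₂ : (threeCoding α β ε).Follows (u + 1) (image σ Letter.b ++ image σ Letter.c) := by
    rw [Coding.follows_append, H.db, add_assoc]
    exact ⟨H.fb, H.fc⟩
  have h₃ := h₂.letterBC
  rw [H.da] at h₁
  rw [Coding.disp_append, H.db, H.dc] at h₃
  have hc := H.count_add
  have hlt := H.lt
  constructor
  · exact H.nonneg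
  · push_cast; omega
  · rw [apotomic_x]; exact h₁.1
  · rw [apotomic_x]; linarith [h₁.2]
  · rw [apotomic_y]; exact h₃.1
  · rw [apotomic_y]; linarith [h₃.2]
  · rw [apotomic_x, apotomic_y, (count_map_BC _).1, (count_map_BC _).1, List.count_append]
    omega
  · rw [apotomic_x, apotomic_y, (count_map_BC _).2, (count_map_BC _).2, List.count_append,
      List.count_append]
    omega

lemma sturmCoded_apoSyntonic (H : PWWFCoded α β u ε σ) :
    SturmCoded (α + β) β (halve (α + 2 * β) (1 - ε) u) (apoSyntonic σ) := by
  have hε : 1 - ε = 0 ∨ 1 - ε = 1 := by have := H.eps; omega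
  have hr := halve_range (n := α + 2 * β) (by have := H.odd; omega) hε H.nonneg H.lt
  have h₁ := H.follows_ab.letterAB H.odd H.eps
  have h₂ := H.fc.letterAB H.odd H.eps
  rw [H.disp_ab, halve_add_two] at h₁
  rw [H.dc, halve_add_two, add_neg_cancel_right] at h₂
  have hc := H.count_add
  constructor
  · exact hr.1
  · push_cast; linarith [hr.2]
  · rw [apoSyntonic_x]; exact h₁.1
  · rw [apoSyntonic_x]; linarith [h₁.2]
  · rw [apoSyntonic_y]; exact h₂.1
  · rw [apoSyntonic_y]; linarith [h₂.2]
  · rw [apoSyntonic_x, apoSyntonic_y, (count_map_AB _).1, (count_map_AB _).1, List.count_append,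
      List.count_append]
    omega
  · rw [apoSyntonic_x, apoSyntonic_y, (count_map_AB _).2, (count_map_AB _).2, List.count_append]
    omega

lemma sturmCoded_syntonic (H : PWWFCoded α β u ε σ) :
    SturmCoded (α + β) β (halve (α + 2 * β) ε u) (syntonic σ) := by
  have hr := halve_range (n := α + 2 * β) (by have := H.odd; omega) H.eps H.nonneg H.lt
  have h₁ := H.follows_ab.letterCA H.odd H.eps
  have h₂ := H.fc.letterCA H.odd H.eps
  rw [H.disp_ab, halve_add_two] at h₁
  rw [H.dc, halve_add_two, add_neg_cancel_right] at h₂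
  have hc := H.count_add
  constructor
  · exact hr.1
  · push_cast; linarith [hr.2]
  · rw [syntonic_x]; exact h₁.1
  · rw [syntonic_x]; linarith [h₁.2]
  · rw [syntonic_y]; exact h₂.1
  · rw [syntonic_y]; linarith [h₂.2]
  · rw [syntonic_x, syntonic_y, (count_map_CA _).1, (count_map_CA _).1, List.count_append,
      List.count_append]
    omega
  · rw [syntonic_x, syntonic_y, (count_map_CA _).2, (count_map_CA _).2, List.count_append]
    omega

lemma isAuthentic (H : PWWFCoded α β u ε σ) : IsAuthentic σ :=
  ⟨H.sturmCoded_apotomic.mem.1, H.sturmCoded_apoSyntonic.mem.1, H.sturmCoded_syntonic.mem.1⟩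

end PWWFCoded

/-! ### The parameters of a class -/

/-- Along an orbit the letters `b` and `c` alternate, so the surplus of `b` is read off the parities
of the end points. -/
lemma Coding.Follows.count_b_sub_count_c {α β : ℕ} {ε : ℤ} (hα : α % 2 = 1) {l : List Letter} :
    ∀ {u : ℤ}, (threeCoding α β ε).Follows u l → (l.count Letter.b : ℤ) - l.count Letter.c =
      (u + ε) % 2 - (u + (threeCoding α β ε).disp l + ε) % 2 := by
  induction l with
  | nil => intro u _; simp
  | cons t l ih =>
    rintro u ⟨h₁, h₂⟩
    have := ih h₂
    rcases t with _ | _ | _ <;> simp at h₁ this ⊢ <;> omega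

/-- The four parameters `bᵢⱼ` of an authentic substitution. They count letters: `b₁₁` the letters
`a` of `σ(a)`, `b₂₁` its other letters, `b₁₂` the letters `a` of `σ(c)` and `b₂₂` its letters `c`. The
number of letters, the lengths of the images and both incidence matrices can be read off. -/
structure HasParams (b₁₁ b₁₂ b₂₁ b₂₂ : ℕ) (α β : ℕ) (σ : Subst3) : Prop where
  det : 2 * (b₁₁ : ℤ) * b₂₂ - b₁₂ * b₂₁ = 1
  hα : α = 2 * b₁₁ + b₁₂
  hβ : β = b₂₁ + b₂₂
  la : (image σ Letter.a).length = b₁₁ + b₂₁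
  lb : (image σ Letter.b).length = b₁₁ + b₂₁
  incidence_apotomic : incidence (apotomic σ) = !![b₁₁, b₁₂; b₂₁, 2 * b₂₂] * matR
  incidence_apoSyntonic : incidence (apoSyntonic σ) = matR * !![2 * b₁₁, b₁₂; b₂₁, b₂₂]

lemma PWWFCoded.exists_params {α β : ℕ} {u ε : ℤ} {σ : Subst3} (H : PWWFCoded α β u ε σ) :
    ∃ b₁₁ b₁₂ b₂₁ b₂₂, HasParams b₁₁ b₁₂ b₂₁ b₂₂ α β σ := by
  set p := (image σ Letter.a).count Letter.a with hp
  set r := (image σ Letter.a).count Letter.b + (image σ Letter.a).count Letter.c with hr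
  have hc := H.count_add
  have F := H.sturmCoded_apotomic
  have G := H.sturmCoded_apoSyntonic
  have e₁ : (2 * β : ℤ) * p - α * r = 1 := by
    have := H.da
    rw [threeCoding_disp] at this
    rw [hp, hr]; push_cast; linarith
  have e₂ : (2 * β : ℤ) * (image σ Letter.b).count Letter.a -
      α * ((image σ Letter.b).count Letter.b + (image σ Letter.b).count Letter.c) = 1 := by
    have := H.db
    rwa [threeCoding_disp] at this
  have pos : ∀ q s : ℕ, (2 * β : ℤ) * q - α * s = 1 → 0 < q := by
    intro q s h
    rcases Nat.eq_zero_or_pos q with rfl | hq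
    · have h₁ : (0 : ℤ) ≤ α * s := by positivity
      simp only [Nat.cast_zero, mul_zero] at h
      omega
    · exact hq
  have p₁ := pos _ _ e₁
  have p₂ := pos _ _ (by exact_mod_cast e₂)
  obtain ⟨e₃, e₄⟩ := bezout_unique e₁ e₂ (by omega) (by omega) (by omega) (by omega)
  obtain ⟨b₁₂, hb₁₂⟩ : ∃ b₁₂, α = 2 * p + b₁₂ := Nat.exists_eq_add_of_le (by omega)
  obtain ⟨b₂₂, hb₂₂⟩ : ∃ b₂₂, β = r + b₂₂ := Nat.exists_eq_add_of_le (by omega)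
  refine ⟨p, b₁₂, r, b₂₂, ?_, hb₁₂, hb₂₂, ?_, ?_, ?_, ?_⟩
  · rw [hb₁₂, hb₂₂] at e₁
    push_cast at e₁
    linear_combination e₁
  · rw [length_eq_count_three]; omega
  · rw [length_eq_count_three]; omega
  · unfold incidence
    rw [apotomic_x, apotomic_y, (count_map_BC _).1, (count_map_BC _).2, (count_map_BC _).1,
      (count_map_BC _).2, List.count_append, List.count_append, List.count_append, matR]
    ext i j
    fin_cases i <;> fin_cases j <;> simp <;> omega
  · have g := G.det
    have gx := G.count_pos
    have hx := G.count_x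
    unfold incidence
    rw [apoSyntonic_x] at g gx hx
    rw [apoSyntonic_y] at hx
    rw [apoSyntonic_x, apoSyntonic_y]
    rw [(count_map_AB _).1] at g gx hx
    rw [(count_map_AB _).1] at hx
    rw [(count_map_AB _).2] at g
    rw [(count_map_AB _).1, (count_map_AB _).2, (count_map_AB _).1, (count_map_AB _).2]
    simp only [List.count_append] at g gx hx ⊢
    obtain ⟨g₁, g₂⟩ := bezout_unique (p' := 2 * p + r) (r' := r) g
      (by push_cast; linear_combination e₁) (by omega) (by omega) (by omega) (by omega)
    rw [matR]
    ext i j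
    fin_cases i <;> fin_cases j <;> simp <;> omega

lemma params_pos {b₁₁ b₁₂ b₂₁ b₂₂ : ℕ} (hb : 2 * (b₁₁ : ℤ) * b₂₂ - b₁₂ * b₂₁ = 1) :
    0 < b₁₁ := by
  rcases Nat.eq_zero_or_pos b₁₁ with rfl | h
  · have : (0 : ℤ) ≤ b₁₂ * b₂₁ := by positivity
    simp only [Nat.cast_zero, mul_zero, zero_mul] at hb
    omega
  · exact h

/-- The parameters are determined by the numbers of letters. -/
lemma params_unique {b₁₁ b₁₂ b₂₁ b₂₂ b'₁₁ b'₁₂ b'₂₁ b'₂₂ α β : ℕ}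
    (hb : 2 * (b₁₁ : ℤ) * b₂₂ - b₁₂ * b₂₁ = 1) (hb' : 2 * (b'₁₁ : ℤ) * b'₂₂ - b'₁₂ * b'₂₁ = 1)
    (hα : α = 2 * b₁₁ + b₁₂) (hα' : α = 2 * b'₁₁ + b'₁₂) (hβ : β = b₂₁ + b₂₂)
    (hβ' : β = b'₂₁ + b'₂₂) : b₁₁ = b'₁₁ ∧ b₁₂ = b'₁₂ ∧ b₂₁ = b'₂₁ ∧ b₂₂ = b'₂₂ := by
  have h₁ := params_pos hb
  have h₂ := params_pos hb'
  have := bezout_unique (h := α) (k := 2 * β) (p := b₁₁) (r := b₂₁) (p' := b'₁₁) (r' := b'₂₁)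
    (by rw [hα, hβ]; push_cast; linear_combination hb)
    (by rw [hα', hβ']; push_cast; linear_combination hb')
    (by omega) (by omega) (by omega) (by omega)
  omega

/-- The substitution of `{a, b, c}*` with given images. -/
def subst3 (X Y Z : List Letter) : Subst3 :=
  FreeMonoid.lift (fun t => match t with
    | Letter.a => FreeMonoid.ofList X
    | Letter.b => FreeMonoid.ofList Y
    | Letter.c => FreeMonoid.ofList Z)

lemma image_subst3_a (X Y Z : List Letter) : image (subst3 X Y Z) Letter.a = X :=
  congrArg FreeMonoid.toList (FreeMonoid.lift_eval_of _ _)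

lemma image_subst3_b (X Y Z : List Letter) : image (subst3 X Y Z) Letter.b = Y :=
  congrArg FreeMonoid.toList (FreeMonoid.lift_eval_of _ _)

lemma image_subst3_c (X Y Z : List Letter) : image (subst3 X Y Z) Letter.c = Z :=
  congrArg FreeMonoid.toList (FreeMonoid.lift_eval_of _ _)

/-- All parameters, admissible starting points and parities occur. -/
lemma exists_coded_hasParams {b₁₁ b₁₂ b₂₁ b₂₂ α β : ℕ} {u ε : ℤ}
    (hb : 2 * (b₁₁ : ℤ) * b₂₂ - b₁₂ * b₂₁ = 1) (hα : α = 2 * b₁₁ + b₁₂) (hβ : β = b₂₁ + b₂₂)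
    (hε : ε = 0 ∨ ε = 1) (hu : 0 ≤ u) (hu' : u + 2 < α + 2 * β) :
    ∃ σ, PWWFCoded α β u ε σ ∧ HasParams b₁₁ b₁₂ b₂₁ b₂₂ α β σ := by
  have hodd : α % 2 = 1 := by
    by_contra hne
    obtain ⟨j, hj⟩ : ∃ j, b₁₂ = 2 * j := ⟨b₁₂ / 2, by omega⟩
    rw [hj] at hb
    push_cast at hb
    have : (2 : ℤ) * (b₁₁ * b₂₂ - j * b₂₁) = 1 := by linear_combination hb
    omega
  have dvd₁ : ((threeCoding α β ε).n : ℤ) ∣ 1 - (threeCoding α β ε).k * (b₁₁ + b₂₁ : ℕ) := by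
    refine ⟨-b₂₁, ?_⟩
    rw [threeCoding_n, threeCoding_k, hα, hβ]
    push_cast
    linear_combination -hb
  have dvd₂ : ((threeCoding α β ε).n : ℤ) ∣ -2 - (threeCoding α β ε).k * (b₁₂ + 2 * b₂₂ : ℕ) := by
    refine ⟨-2 * b₂₂, ?_⟩
    rw [threeCoding_n, threeCoding_k, hα, hβ]
    push_cast
    linear_combination 2 * hb
  obtain ⟨X, hX, fX⟩ := (threeCoding α β ε).exists_follows (b₁₁ + b₂₁) (u := u) hu
    (by rw [threeCoding_n]; omega)
  obtain ⟨Y, hY, fY⟩ := (threeCoding α β ε).exists_follows (b₁₁ + b₂₁) (u := u + 1) (by omega)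
    (by rw [threeCoding_n]; omega)
  obtain ⟨Z, hZ, fZ⟩ := (threeCoding α β ε).exists_follows (b₁₂ + 2 * b₂₂) (u := u + 2) (by omega)
    (by rw [threeCoding_n]; omega)
  have dX : (threeCoding α β ε).disp X = 1 := fX.disp_eq hu (by rw [threeCoding_n]; omega)
    (by omega) (by rw [threeCoding_n]; omega) (by rwa [hX])
  have dY : (threeCoding α β ε).disp Y = 1 := fY.disp_eq (by omega) (by rw [threeCoding_n]; omega)
    (by omega) (by rw [threeCoding_n]; omega) (by rwa [hY])
  have dZ : (threeCoding α β ε).disp Z = -2 := fZ.disp_eq (by omega) (by rw [threeCoding_n]; omega)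
    (by omega) (by rw [threeCoding_n]; omega) (by rwa [hZ])
  have fW : (threeCoding α β ε).Follows u (X ++ Y ++ Z) := by
    rw [Coding.follows_append, Coding.follows_append, Coding.disp_append, dX, dY]
    exact ⟨⟨fX, fY⟩, fZ⟩
  have dW : (threeCoding α β ε).disp (X ++ Y ++ Z) = 0 := by
    rw [Coding.disp_append, Coding.disp_append, dX, dY, dZ]
    norm_num
  have lW : (X ++ Y ++ Z).length = α + 2 * β := by
    rw [List.length_append, List.length_append, hX, hY, hZ, hα, hβ]
    ring
  rw [length_eq_count_three] at lW
  have sW := fW.count_b_sub_count_c hodd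
  rw [dW, add_zero, sub_self] at sW
  rw [threeCoding_disp] at dW
  have cA : (X ++ Y ++ Z).count Letter.a = α := by
    have h₁ : ((X ++ Y ++ Z).count Letter.a + (X ++ Y ++ Z).count Letter.b +
      (X ++ Y ++ Z).count Letter.c : ℤ) = α + 2 * β := by exact_mod_cast lW
    have h₂ : (α + 2 * β : ℤ) * ((X ++ Y ++ Z).count Letter.a - α) = 0 := by
      linear_combination dW + α * h₁
    have h₃ : (α + 2 * β : ℤ) ≠ 0 := by omega
    have h₄ := (mul_eq_zero.mp h₂).resolve_left h₃
    omega
  have hW : modeWord (subst3 X Y Z) = X ++ Y ++ Z := by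
    rw [modeWord_eq, image_subst3_a, image_subst3_b, image_subst3_c]
  have H : PWWFCoded α β u ε (subst3 X Y Z) := by
    refine ⟨hu, hu', hodd, hε, ?_, ?_, ?_, ?_, ?_, ?_, ?_, ?_, ?_⟩
    · rwa [image_subst3_a]
    · rwa [image_subst3_a]
    · rwa [image_subst3_b]
    · rwa [image_subst3_b]
    · rwa [image_subst3_c]
    · rwa [image_subst3_c]
    · rwa [hW]
    · rw [hW]; omega
    · rw [hW]; omega
  refine ⟨_, H, ?_⟩
  obtain ⟨c₁₁, c₁₂, c₂₁, c₂₂, P⟩ := H.exists_params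
  obtain ⟨rfl, rfl, rfl, rfl⟩ := params_unique hb P.det hα P.hα hβ P.hβ
  exact P

/-! ### Conjugation -/

namespace PWWFCoded

variable {α β α' β' : ℕ} {u u' ε ε' : ℤ} {σ τ : Subst3}

lemma isCoprime (H : PWWFCoded α β u ε σ) :
    IsCoprime (threeCoding α β ε).k (threeCoding α β ε).n := by
  simpa using H.sturmCoded_apotomic.isCoprime_k_n

lemma sameLengths (H : PWWFCoded α β u ε σ) (H' : PWWFCoded α β u' ε' τ) : SameLengths σ τ := by
  obtain ⟨b₁₁, b₁₂, b₂₁, b₂₂, P⟩ := H.exists_params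
  obtain ⟨c₁₁, c₁₂, c₂₁, c₂₂, Q⟩ := H'.exists_params
  obtain ⟨rfl, rfl, rfl, rfl⟩ := params_unique P.det Q.det P.hα Q.hα P.hβ Q.hβ
  have h₁ := H.length_modeWord
  have h₂ := H'.length_modeWord
  rw [modeWord_eq, List.length_append, List.length_append, P.la, P.lb] at h₁
  rw [modeWord_eq, List.length_append, List.length_append, Q.la, Q.lb] at h₂
  rintro (_ | _ | _)
  · exact P.la.trans Q.la.symm
  · exact P.lb.trans Q.lb.symm
  · change (image σ Letter.c).length = (image τ Letter.c).length
    omega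

lemma ext (H : PWWFCoded α β u ε σ) (H' : PWWFCoded α β u ε τ) : σ = τ := by
  have hl := H.sameLengths H'
  apply subst3_ext
  rintro (_ | _ | _)
  · exact H.fa.eq_of_length_eq H'.fa (hl _)
  · exact H.fb.eq_of_length_eq H'.fb (hl _)
  · exact H.fc.eq_of_length_eq H'.fc (hl _)

lemma lt_n (H : PWWFCoded α β u ε σ) : u < (threeCoding α β ε').n := by
  have := H.lt
  rw [threeCoding_n]
  omega

lemma isConjugate (H : PWWFCoded α β u ε σ) (H' : PWWFCoded α β u' ε τ) : IsConjugate σ τ :=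
  ⟨H.sameLengths H', H.follows_modeWord.isRotated H'.follows_modeWord H.nonneg H.lt_n H'.nonneg
    H'.lt_n H.isCoprime (by rw [H.length_modeWord]; simp) (by rw [H'.length_modeWord]; simp)
    H.disp_modeWord⟩

/-- Reversal replaces `u` by `n - 1 - u`, which exchanges the roles of the parities. -/
lemma exists_follows_reverse (H : PWWFCoded α β u ε σ) (hε : ε + ε' = 1) :
    ∃ v, 0 ≤ v ∧ v < (threeCoding α β ε').n ∧
      (threeCoding α β ε').Follows v (modeWord σ).reverse := by
  have hu := H.nonneg
  have hlt := H.lt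
  have hodd := H.odd
  have h := (Coding.Follows.reverse (D := threeCoding α β ε') (χ := fun v => α + 2 * β - 1 - v)
    (by rintro (_ | _ | _) w hw <;> simp at hw ⊢ <;> omega) H.follows_modeWord).1
  rw [H.disp_modeWord, add_zero] at h
  refine ⟨_, ?_, ?_, h⟩
  · omega
  · rw [threeCoding_n]; omega

lemma isReverseConjugate (H : PWWFCoded α β u ε σ) (H' : PWWFCoded α β u' ε' τ)
    (hε : ε + ε' = 1) : IsReverseConjugate σ τ := by
  obtain ⟨v, h₀, h₁, h⟩ := H.exists_follows_reverse hε
  refine ⟨H.sameLengths H', h.isRotated H'.follows_modeWord h₀ h₁ H'.nonneg H'.lt_n H'.isCoprime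
    ?_ ?_ ?_⟩
  · rw [List.length_reverse, H.length_modeWord]; simp
  · rw [H'.length_modeWord]; simp
  · have := H.disp_modeWord
    rw [threeCoding_disp] at this
    rw [Coding.disp_reverse, threeCoding_disp, this]

end PWWFCoded

/-- A word that contains `b` is read at most with one parity from a given point. -/
lemma parity_unique {α β : ℕ} {ε ε' : ℤ} {l : List Letter} : ∀ {u : ℤ},
    (threeCoding α β ε).Follows u l → (threeCoding α β ε').Follows u l → 0 < l.count Letter.b →
    ε % 2 = ε' % 2 := by
  induction l with
  | nil => intro u _ _ h; simp at h
  | cons t l ih =>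
    rintro u ⟨h₁, h₂⟩ ⟨h₃, h₄⟩ h
    rcases t with _ | _ | _
    · exact ih h₂ h₄ (by simpa using h)
    · simp at h₁ h₃; omega
    · exact ih h₂ h₄ (by simpa using h)

namespace PWWFCoded

variable {α β α' β' : ℕ} {u u' ε ε' : ℤ} {σ τ : Subst3}

/-- The parity `ε` can be read off the cyclic word of a closed orbit. -/
lemma eps_eq_of_isRotated (H' : PWWFCoded α β u' ε' τ) {l : List Letter} {v : ℤ}
    (h : (threeCoding α β ε).Follows v l) (h₀ : 0 ≤ v) (h₁ : v < (threeCoding α β ε).n)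
    (hd : (threeCoding α β ε).disp l = 0) (hr : l ~r modeWord τ) (hε : ε = 0 ∨ ε = 1) :
    ε = ε' := by
  obtain ⟨w, h₂, h₃, h₄⟩ := h.of_isRotated hd hr h₀ h₁
  have e := h₄.start_unique (C := threeCoding α β ε) (C' := threeCoding α β ε') rfl rfl rfl
    H'.follows_modeWord h₂ h₃ H'.nonneg H'.lt_n H'.isCoprime (by rw [H'.length_modeWord]; simp)
  subst e
  have h₅ := parity_unique h₄ H'.follows_modeWord (by
    have := H'.sturmCoded_apotomic.pos.2
    rw [H'.count_b]; omega)
  have := H'.eps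
  omega

lemma eq_of_isConjugate (H : PWWFCoded α β u ε σ) (H' : PWWFCoded α' β' u' ε' τ)
    (h : IsConjugate σ τ) : α = α' ∧ β = β' ∧ ε = ε' := by
  obtain rfl : α = α' := by rw [← H.count_a, ← H'.count_a, h.2.perm.count_eq]
  obtain rfl : β = β' := by rw [← H.count_b, ← H'.count_b, h.2.perm.count_eq]
  exact ⟨rfl, rfl, H'.eps_eq_of_isRotated H.follows_modeWord H.nonneg H.lt_n H.disp_modeWord h.2
    H.eps⟩

lemma eq_of_isReverseConjugate (H : PWWFCoded α β u ε σ) (H' : PWWFCoded α' β' u' ε' τ)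
    (h : IsReverseConjugate σ τ) : α = α' ∧ β = β' ∧ ε + ε' = 1 := by
  obtain rfl : α = α' := by
    rw [← H.count_a, ← H'.count_a, ← h.2.perm.count_eq, List.count_reverse]
  obtain rfl : β = β' := by
    rw [← H.count_b, ← H'.count_b, ← h.2.perm.count_eq, List.count_reverse]
  obtain ⟨v, h₀, h₁, hf⟩ := H.exists_follows_reverse (ε' := 1 - ε) (by ring)
  have := H'.eps_eq_of_isRotated hf h₀ h₁ (by
    have := H.disp_modeWord
    rw [threeCoding_disp] at this
    rw [Coding.disp_reverse, threeCoding_disp, this]) h.2 (by have := H.eps; omega)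
  exact ⟨rfl, rfl, by omega⟩

end PWWFCoded

/-! ### Bisecting substitutions -/

lemma map_bisectFrom (l : List Two) : ∀ p : Bool, (bisectFrom p l).map letterBC = l := by
  induction l with
  | nil => intro p; rfl
  | cons t l ih => rintro (_ | _) <;> rcases t with _ | _ <;> simp [bisectFrom, ih]

lemma toList_mul_xy (f : Subst2) : (f (word Two.x * word Two.y)).toList =
    (f (word Two.x)).toList ++ (f (word Two.y)).toList := by
  rw [map_mul, FreeMonoid.toList_mul]

lemma IsBisectingOf.eq_apotomic {f : Subst2} {σ : Subst3} (h : IsBisectingOf f σ) :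
    f = apotomic σ := by
  obtain ⟨-, -, -, -, ha, hb, hc⟩ := h
  rw [toList_mul_xy] at ha hb hc
  apply subst2_ext
  · rw [apotomic_x, image, ha, List.map_take, bisection, map_bisectFrom]
    exact (List.take_left).symm
  · rw [apotomic_y, image, image, hb, hc, two_mul, ← List.drop_drop, List.take_append_drop,
      List.map_drop, bisection, map_bisectFrom]
    exact (List.drop_left).symm

lemma IsBisectingOf.modeWord_eq_bisection {f : Subst2} {σ : Subst3} (h : IsBisectingOf f σ) :
    modeWord σ = bisection (f (word Two.x * word Two.y)).toList := by
  obtain ⟨-, -, -, -, ha, hb, hc⟩ := h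
  rw [modeWord_eq, image, image, image, ha, hb, hc, two_mul, ← List.drop_drop, List.append_assoc,
    List.take_append_drop, List.take_append_drop]

/-- An orbit word is a bisection of its projection: as `b` and `c` alternate, only the parity of the
starting point decides which of them comes first. -/
lemma Coding.Follows.eq_bisectFrom {α β : ℕ} {ε : ℤ} (hα : α % 2 = 1) {l : List Letter} :
    ∀ {u : ℤ}, (threeCoding α β ε).Follows u l →
      l = bisectFrom (decide ((u + ε) % 2 = 0)) (l.map _root_.letterBC) := by
  induction l with
  | nil => intros; rfl
  | cons t l ih =>
    rintro u ⟨h₁, h₂⟩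
    have h₃ := ih h₂
    rcases t with _ | _ | _
    · have e : (u + (threeCoding α β ε).δ Letter.a + ε) % 2 = (u + ε) % 2 := by simp; omega
      rw [e] at h₃
      simpa [bisectFrom] using h₃
    · have e : (u + (threeCoding α β ε).δ Letter.b + ε) % 2 = 0 := by simp at h₁ ⊢; omega
      have e' : ¬ (u + ε) % 2 = 0 := by simp at h₁ ⊢; omega
      rw [decide_eq_true e] at h₃
      rw [decide_eq_false e']
      simpa [bisectFrom] using h₃
    · have e : ¬ (u + (threeCoding α β ε).δ Letter.c + ε) % 2 = 0 := by simp at h₁ ⊢; omega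
      have e' : (u + ε) % 2 = 0 := by simp at h₁; omega
      rw [decide_eq_false e] at h₃
      rw [decide_eq_true e']
      simpa [bisectFrom] using h₃

lemma bisectFrom_ne {l : List Two} : bisectFrom false l = bisectFrom true l →
    l.count Two.y = 0 := by
  induction l with
  | nil => intro _; rfl
  | cons t l ih => rcases t with _ | _ <;> simp [bisectFrom]; simpa using ih

namespace PWWFCoded

variable {α β α' β' : ℕ} {u u' ε ε' : ℤ} {σ τ : Subst3}

lemma map_modeWord (σ : Subst3) :
    (modeWord σ).map letterBC = (apotomic σ (word Two.x * word Two.y)).toList := by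
  rw [toList_mul_xy, apotomic_x, apotomic_y, ← List.map_append, modeWord_eq, List.append_assoc]

/-- In a class whose parity is `ε = 0`, bisecting means to start at the point `2β - 1`. -/
lemma eq_of_isBisecting (H : PWWFCoded α β u ε σ) (h : IsBisecting σ) :
    u = 2 * β - 1 ∧ ε = 0 := by
  obtain ⟨f, hf⟩ := h
  obtain rfl := hf.eq_apotomic
  obtain ⟨h, k, F⟩ := exists_sturmCoded_of_standard hf.1
  obtain ⟨rfl, rfl, hu⟩ := H.sturmCoded_apotomic.unique F
  have hu' : u = 2 * β - 1 := by push_cast at hu; exact hu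
  refine ⟨hu', ?_⟩
  rcases H.eps with hε | hε
  · exact hε
  -- for `ε = 1` the first letter other than `a` would be `c`
  exfalso
  have h₁ := H.follows_modeWord.eq_bisectFrom H.odd
  have e : (u + ε) % 2 = 0 := by omega
  rw [hf.modeWord_eq_bisection, decide_eq_true e, bisection, map_bisectFrom] at h₁
  have h₂ := bisectFrom_ne h₁
  have h₃ := H.sturmCoded_apotomic.count_y
  have h₄ := H.sturmCoded_apotomic.pos.2
  rw [toList_mul_xy, List.count_append] at h₂
  omega

lemma isBisectingOf (H : PWWFCoded α β (2 * β - 1) 0 σ) : IsBisectingOf (apotomic σ) σ := by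
  have F := H.sturmCoded_apotomic
  obtain ⟨b₁₁, b₁₂, b₂₁, b₂₂, P⟩ := H.exists_params
  have hlen := H.length_modeWord
  have h₁ : modeWord σ = bisection (apotomic σ (word Two.x * word Two.y)).toList := by
    have := H.follows_modeWord.eq_bisectFrom H.odd
    rw [map_modeWord] at this
    have e : ¬ (2 * (β : ℤ) - 1 + 0) % 2 = 0 := by omega
    rwa [decide_eq_false e] at this
  have hx : (apotomic σ (word Two.x)).length = (image σ Letter.a).length := by
    change (apotomic σ (word Two.x)).toList.length = _
    rw [apotomic_x, List.length_map]
  have hab : (image σ Letter.b).length = (image σ Letter.a).length := P.lb.trans P.la.symm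
  have hxy : (apotomic σ (word Two.x * word Two.y)).length = α + 2 * β := F.length_mul
  have hα := P.hα
  have hβ := P.hβ
  have hodd := H.odd
  have la := P.la
  refine ⟨?_, ?_, ?_, ?_, ?_, ?_, ?_⟩
  · exact F.mem.2 (by push_cast; ring)
  · rw [hxy, Nat.odd_iff]; omega
  · rw [toList_mul_xy, List.count_append, F.count_y]
    exact even_two_mul β
  · rw [hx, hxy, P.la]; omega
  · rw [hx, ← h₁, modeWord_eq, List.append_assoc, List.take_left]
    rfl
  · rw [hx, ← h₁, modeWord_eq, List.append_assoc, List.drop_left, ← hab, List.take_left]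
    rfl
  · rw [hx, ← h₁, modeWord_eq, two_mul, ← List.drop_drop, List.append_assoc, List.drop_left, ← hab,
      List.drop_left]
    rfl

/-- The starting point `2β - 1` is admissible. -/
lemma exists_start (H : PWWFCoded α β u ε σ) (hε' : ε' = 0 ∨ ε' = 1) :
    ∃ τ, PWWFCoded α β (2 * β - 1) ε' τ := by
  obtain ⟨b₁₁, b₁₂, b₂₁, b₂₂, P⟩ := H.exists_params
  have h₁ := H.sturmCoded_apotomic.pos.2
  have h₂ := params_pos P.det
  have h₃ := P.hα
  obtain ⟨τ, hτ, -⟩ := exists_coded_hasParams (u := 2 * β - 1) P.det P.hα P.hβ hε' (by omega)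
    (by omega)
  exact ⟨τ, hτ⟩

end PWWFCoded

/-! ### Classification of the classes -/

lemma exists_isBisecting_isConjugate_iff {α β : ℕ} {u ε : ℤ} {σ : Subst3}
    (H : PWWFCoded α β u ε σ) :
    (∃ τ : AuthenticSubst, IsBisecting τ.1 ∧ IsConjugate σ τ.1) ↔ ε = 0 := by
  constructor
  · rintro ⟨τ, hτ, h⟩
    obtain ⟨α', β', u', ε', H'⟩ := τ.2.exists_coded
    obtain ⟨-, -, rfl⟩ := H.eq_of_isConjugate H' h
    exact (H'.eq_of_isBisecting hτ).2
  · rintro rfl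
    obtain ⟨τ, hτ⟩ := H.exists_start (ε' := 0) (Or.inl rfl)
    exact ⟨⟨τ, hτ.isAuthentic⟩, ⟨_, hτ.isBisectingOf⟩, H.isConjugate hτ⟩

lemma exists_isBisecting_isReverseConjugate_iff {α β : ℕ} {u ε : ℤ} {σ : Subst3}
    (H : PWWFCoded α β u ε σ) :
    (∃ τ : AuthenticSubst, IsBisecting τ.1 ∧ IsReverseConjugate σ τ.1) ↔ ε = 1 := by
  constructor
  · rintro ⟨τ, hτ, h⟩
    obtain ⟨α', β', u', ε', H'⟩ := τ.2.exists_coded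
    obtain ⟨-, -, hε⟩ := H.eq_of_isReverseConjugate H' h
    have := (H'.eq_of_isBisecting hτ).2
    omega
  · rintro rfl
    obtain ⟨τ, hτ⟩ := H.exists_start (ε' := 0) (Or.inl rfl)
    exact ⟨⟨τ, hτ.isAuthentic⟩, ⟨_, hτ.isBisectingOf⟩, H.isReverseConjugate hτ (by norm_num)⟩

/-- Conjugation and reverse conjugation together forget only the starting point and the parity. -/
lemma conjugate_or_reverse_iff {α β α' β' : ℕ} {u u' ε ε' : ℤ} {σ τ : Subst3}
    (H : PWWFCoded α β u ε σ) (H' : PWWFCoded α' β' u' ε' τ) :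
    (IsConjugate σ τ ∨ IsReverseConjugate σ τ) ↔ α = α' ∧ β = β' := by
  constructor
  · rintro (h | h)
    · exact ⟨(H.eq_of_isConjugate H' h).1, (H.eq_of_isConjugate H' h).2.1⟩
    · exact ⟨(H.eq_of_isReverseConjugate H' h).1, (H.eq_of_isReverseConjugate H' h).2.1⟩
  · rintro ⟨rfl, rfl⟩
    have h := H.eps
    have h' := H'.eps
    by_cases hε : ε = ε'
    · subst hε
      exact Or.inl (H.isConjugate H')
    · exact Or.inr (H.isReverseConjugate H' (by omega))

/-- Two matrices of the set `Σ₂` are equal only if their parameters are. -/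
lemma lower_injective {b₁₁ b₁₂ b₂₁ b₂₂ c₁₁ c₁₂ c₂₁ c₂₂ : ℕ}
    (h : !![b₁₁, b₁₂; b₂₁, 2 * b₂₂] * matR = !![c₁₁, c₁₂; c₂₁, 2 * c₂₂] * matR) :
    b₁₁ = c₁₁ ∧ b₁₂ = c₁₂ ∧ b₂₁ = c₂₁ ∧ b₂₂ = c₂₂ := by
  have h₁ := congrFun (congrFun h 0) 0
  have h₂ := congrFun (congrFun h 0) 1
  have h₃ := congrFun (congrFun h 1) 0
  have h₄ := congrFun (congrFun h 1) 1
  simp [matR] at h₁ h₂ h₃ h₄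
  omega

lemma upper_injective {b₁₁ b₁₂ b₂₁ b₂₂ c₁₁ c₁₂ c₂₁ c₂₂ : ℕ}
    (h : matR * !![2 * b₁₁, b₁₂; b₂₁, b₂₂] = matR * !![2 * c₁₁, c₁₂; c₂₁, c₂₂]) :
    b₁₁ = c₁₁ ∧ b₁₂ = c₁₂ ∧ b₂₁ = c₂₁ ∧ b₂₂ = c₂₂ := by
  have h₁ := congrFun (congrFun h 0) 0
  have h₂ := congrFun (congrFun h 0) 1
  have h₃ := congrFun (congrFun h 1) 0
  have h₄ := congrFun (congrFun h 1) 1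
  simp [matR] at h₁ h₂ h₃ h₄
  omega

/-- What both incidence matrices have in common: `M` attaches a matrix to a substitution and, on the
authentic ones, takes its values in `S`, determines the numbers of letters and is determined by them,
and attains each value of `S` at a bisecting substitution. -/
structure Classifies (M : Subst3 → Matrix (Fin 2) (Fin 2) ℕ)
    (S : Set (Matrix (Fin 2) (Fin 2) ℕ)) : Prop where
  mem : ∀ {α β u ε σ}, PWWFCoded α β u ε σ → M σ ∈ S
  eq_iff : ∀ {α β α' β' u u' ε ε' σ τ}, PWWFCoded α β u ε σ → PWWFCoded α' β' u' ε' τ →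
    (M σ = M τ ↔ α = α' ∧ β = β')
  surj : ∀ m ∈ S, ∃ (α β : ℕ) (σ : Subst3), PWWFCoded α β (2 * β - 1) 0 σ ∧ M σ = m

lemma exists_start_of_det {b₁₁ b₁₂ b₂₁ b₂₂ : ℕ}
    (hb : 2 * (b₁₁ : ℤ) * b₂₂ - b₁₂ * b₂₁ = 1) :
    ∃ (α β : ℕ) (σ : Subst3), PWWFCoded α β (2 * β - 1) 0 σ ∧
      HasParams b₁₁ b₁₂ b₂₁ b₂₂ α β σ := by
  have h₁ := params_pos hb
  have h₂ : 0 < b₂₂ := by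
    rcases Nat.eq_zero_or_pos b₂₂ with rfl | h
    · have : (0 : ℤ) ≤ b₁₂ * b₂₁ := by positivity
      simp only [Nat.cast_zero, mul_zero] at hb
      omega
    · exact h
  obtain ⟨σ, h⟩ := exists_coded_hasParams (u := 2 * (b₂₁ + b₂₂ : ℕ) - 1) hb rfl rfl (Or.inl rfl)
    (by omega) (by omega)
  exact ⟨_, _, σ, h⟩

lemma classifies_apotomic : Classifies (fun σ => incidence (apotomic σ)) sigmaLower where
  mem H := by
    obtain ⟨b₁₁, b₁₂, b₂₁, b₂₂, P⟩ := H.exists_params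
    exact ⟨_, _, _, _, P.det, P.incidence_apotomic⟩
  eq_iff H H' := by
    constructor
    · intro h
      obtain ⟨b₁₁, b₁₂, b₂₁, b₂₂, P⟩ := H.exists_params
      obtain ⟨c₁₁, c₁₂, c₂₁, c₂₂, Q⟩ := H'.exists_params
      obtain ⟨rfl, rfl, rfl, rfl⟩ := lower_injective
        (P.incidence_apotomic.symm.trans (h.trans Q.incidence_apotomic))
      exact ⟨P.hα.trans Q.hα.symm, P.hβ.trans Q.hβ.symm⟩
    · rintro ⟨rfl, rfl⟩
      exact H.sturmCoded_apotomic.incidence_eq H'.sturmCoded_apotomic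
  surj := by
    rintro m ⟨b₁₁, b₁₂, b₂₁, b₂₂, hb, rfl⟩
    obtain ⟨α, β, σ, H, P⟩ := exists_start_of_det hb
    exact ⟨α, β, σ, H, P.incidence_apotomic⟩

lemma classifies_apoSyntonic : Classifies (fun σ => incidence (apoSyntonic σ)) sigmaUpper where
  mem H := by
    obtain ⟨b₁₁, b₁₂, b₂₁, b₂₂, P⟩ := H.exists_params
    exact ⟨_, _, _, _, P.det, P.incidence_apoSyntonic⟩
  eq_iff H H' := by
    constructor
    · intro h
      obtain ⟨b₁₁, b₁₂, b₂₁, b₂₂, P⟩ := H.exists_params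
      obtain ⟨c₁₁, c₁₂, c₂₁, c₂₂, Q⟩ := H'.exists_params
      obtain ⟨rfl, rfl, rfl, rfl⟩ := upper_injective
        (P.incidence_apoSyntonic.symm.trans (h.trans Q.incidence_apoSyntonic))
      exact ⟨P.hα.trans Q.hα.symm, P.hβ.trans Q.hβ.symm⟩
    · rintro ⟨rfl, rfl⟩
      exact H.sturmCoded_apoSyntonic.incidence_eq H'.sturmCoded_apoSyntonic
  surj := by
    rintro m ⟨b₁₁, b₁₂, b₂₁, b₂₂, hb, rfl⟩
    obtain ⟨α, β, σ, H, P⟩ := exists_start_of_det hb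
    exact ⟨α, β, σ, H, P.incidence_apoSyntonic⟩

lemma Classifies.bijOn {M : Subst3 → Matrix (Fin 2) (Fin 2) ℕ}
    {S : Set (Matrix (Fin 2) (Fin 2) ℕ)} (hM : Classifies M S) :
    ∃ F : ConjugationClass → Matrix (Fin 2) (Fin 2) ℕ,
      (∀ σ : AuthenticSubst, F (Quotient.mk conjugation σ) = M σ.1) ∧
      Set.BijOn F bisectingClasses S := by
  refine ⟨Quotient.lift (fun σ : AuthenticSubst => M σ.1) ?_, fun _ => rfl, ?_, ?_, ?_⟩
  · intro σ τ h
    obtain ⟨α, β, u, ε, H⟩ := σ.2.exists_coded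
    obtain ⟨α', β', u', ε', H'⟩ := τ.2.exists_coded
    have := H.eq_of_isConjugate H' h
    exact (hM.eq_iff H H').mpr ⟨this.1, this.2.1⟩
  · rintro _ ⟨σ, -, rfl⟩
    obtain ⟨α, β, u, ε, H⟩ := σ.2.exists_coded
    exact hM.mem H
  · rintro _ ⟨σ, hσ, rfl⟩ _ ⟨τ, hτ, rfl⟩ h
    obtain ⟨α, β, u, ε, H⟩ := σ.2.exists_coded
    obtain ⟨α', β', u', ε', H'⟩ := τ.2.exists_coded
    obtain ⟨rfl, rfl⟩ := (hM.eq_iff H H').mp h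
    obtain ⟨-, rfl⟩ := H.eq_of_isBisecting hσ
    obtain ⟨-, rfl⟩ := H'.eq_of_isBisecting hτ
    exact Quotient.sound (H.isConjugate H')
  · intro m hm
    obtain ⟨α, β, σ, H, rfl⟩ := hM.surj m hm
    exact ⟨Quotient.mk conjugation ⟨σ, H.isAuthentic⟩, ⟨_, ⟨_, H.isBisectingOf⟩, rfl⟩, rfl⟩

lemma Classifies.exists_equiv {M : Subst3 → Matrix (Fin 2) (Fin 2) ℕ}
    {S : Set (Matrix (Fin 2) (Fin 2) ℕ)} (hM : Classifies M S) :
    ∃ Φ : PairedClass ≃ S, ∀ σ : AuthenticSubst,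
      (Φ (Quotient.mk conjugationUpToReversal σ) : Matrix (Fin 2) (Fin 2) ℕ) = M σ.1 := by
  have mem : ∀ σ : AuthenticSubst, M σ.1 ∈ S := by
    intro σ
    obtain ⟨α, β, u, ε, H⟩ := σ.2.exists_coded
    exact hM.mem H
  have key : ∀ σ τ : AuthenticSubst, conjugationUpToReversal σ τ ↔ M σ.1 = M τ.1 := by
    intro σ τ
    obtain ⟨α, β, u, ε, H⟩ := σ.2.exists_coded
    obtain ⟨α', β', u', ε', H'⟩ := τ.2.exists_coded
    exact (conjugate_or_reverse_iff H H').trans (hM.eq_iff H H').symm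
  let Φ : PairedClass → S := Quotient.lift (fun σ : AuthenticSubst => (⟨M σ.1, mem σ⟩ : S))
    (fun σ τ h => Subtype.ext ((key σ τ).mp h))
  have hΦ : Function.Bijective Φ := by
    constructor
    · intro p q
      refine Quotient.inductionOn₂ p q fun σ τ h => ?_
      exact Quotient.sound ((key σ τ).mpr (congrArg Subtype.val h))
    · rintro ⟨m, hm⟩
      obtain ⟨α, β, σ, H, rfl⟩ := hM.surj m hm
      exact ⟨Quotient.mk conjugationUpToReversal ⟨σ, H.isAuthentic⟩, rfl⟩
  exact ⟨Equiv.ofBijective Φ hΦ, fun _ => rfl⟩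

theorem mainTheorem5 :
    -- every authentic substitution is conjugate to a bisecting one, up to reversal, and the two
    -- cases exclude each other
    (∀ σ : AuthenticSubst,
      Xor (∃ τ : AuthenticSubst, IsBisecting τ.1 ∧ IsConjugate σ.1 τ.1)
        (∃ τ : AuthenticSubst, IsBisecting τ.1 ∧ IsReverseConjugate σ.1 τ.1)) ∧
    -- a conjugation class with a bisecting representative has just one, and its apotomic
    -- projection is special standard
    (∀ κ ∈ bisectingClasses, ∃! σ : AuthenticSubst,
      Quotient.mk conjugation σ = κ ∧ IsBisectingOf (apotomic σ.1) σ.1) ∧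
    -- the conjugation classes of bisecting substitutions are parametrized by both sets
    (∃ F : ConjugationClass → Matrix (Fin 2) (Fin 2) ℕ,
      (∀ σ : AuthenticSubst, F (Quotient.mk conjugation σ) = incidence (apotomic σ.1)) ∧
      Set.BijOn F bisectingClasses sigmaLower) ∧
    (∃ F : ConjugationClass → Matrix (Fin 2) (Fin 2) ℕ,
      (∀ σ : AuthenticSubst, F (Quotient.mk conjugation σ) = incidence (apoSyntonic σ.1)) ∧
      Set.BijOn F bisectingClasses sigmaUpper) ∧
    -- the conjugation classes of all authentic substitutions, each paired with its reversal, are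
    -- parametrized by both sets
    (∃ Φ : PairedClass ≃ sigmaLower, ∀ σ : AuthenticSubst,
      (Φ (Quotient.mk conjugationUpToReversal σ) : Matrix (Fin 2) (Fin 2) ℕ) =
        incidence (apotomic σ.1)) ∧
    (∃ Ψ : PairedClass ≃ sigmaUpper, ∀ σ : AuthenticSubst,
      (Ψ (Quotient.mk conjugationUpToReversal σ) : Matrix (Fin 2) (Fin 2) ℕ) =
        incidence (apoSyntonic σ.1)) := by
  refine ⟨fun σ => ?_, ?_, classifies_apotomic.bijOn, classifies_apoSyntonic.bijOn,
    classifies_apotomic.exists_equiv, classifies_apoSyntonic.exists_equiv⟩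
  · obtain ⟨α, β, u, ε, H⟩ := σ.2.exists_coded
    rw [exists_isBisecting_isConjugate_iff H, exists_isBisecting_isReverseConjugate_iff H]
    rcases H.eps with rfl | rfl
    · exact Or.inl ⟨rfl, by norm_num⟩
    · exact Or.inr ⟨rfl, by norm_num⟩
  · rintro _ ⟨σ, hσ, rfl⟩
    have hf : IsBisectingOf (apotomic σ.1) σ.1 := by
      obtain ⟨f, hf⟩ := hσ
      obtain rfl := hf.eq_apotomic
      exact hf
    refine ⟨σ, ⟨rfl, hf⟩, ?_⟩
    rintro τ ⟨hτ, hτ'⟩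
    obtain ⟨α, β, u, ε, H⟩ := σ.2.exists_coded
    obtain ⟨α', β', u', ε', H'⟩ := τ.2.exists_coded
    obtain ⟨rfl, rfl, rfl⟩ := H'.eq_of_isConjugate H (Quotient.exact hτ)
    obtain ⟨rfl, -⟩ := H.eq_of_isBisecting hσ
    obtain ⟨rfl, -⟩ := H'.eq_of_isBisecting ⟨_, hτ'⟩
    exact Subtype.ext (H'.ext H)
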